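/- **Setting.** Let $\Omega\subset\mathbb{C}$ be open and simply connected and $z_0\in\Omega$. Put $J=\begin{pmatrix}0&-1\\1&0\end{pmatrix}$, and let $\tau$ be the automorphism $\tau(M)=-\mathrm{diag}(-J,1)\,{}^tM\,\mathrm{diag}(J,1)$ of $\mathfrak{u}(3)^{\mathbb C}=M(3,\mathbb{C})$ and $\tau(g)=\mathrm{diag}(-J,1)\,{}^tg^{-1}\,\mathrm{diag}(J,1)$ of $GL(3,\mathbb{C})$. Let $\mathfrak{u}(3)^{\mathbb C}_a$ be the eigenspace of $\tau$ for the eigenvalue $i^a$, let $\mathfrak u(3)_0=\mathfrak u(3)^{\mathbb C}_0\cap\mathfrak u(3)$, and let $U(3)_0=\{\mathrm{diag}(g,1): g\in SU(2)\}\cong SU(2)$, a group of fixed points of $\tau$. A *family of Hamiltonian stationary conformal Lagrangian immersions* is a family of smooth maps $F_\lambda:\Omega\to U(3)$, $\lambda\in S^1$, with $\tau(F_\lambda)=F_{i\lambda}$, such that $F:=F_{\lambda=1}$ is a Legendrian framing of a Hamiltonian stationary conformal Lagrangian immersion $u:\Omega\to\mathbb{C}P^2$ (the last column $\hat u:\Omega\to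 S^5$ of $F$ is a horizontal lift of $u$, and $\det F=e^{i\beta}=\det\big(\tfrac{\hat u_x}{|\hat u_x|},\tfrac{\hat u_y}{|\hat u_y|},\hat u\big)$; Hamiltonian stationary means that the first variation of area vanishes along $J\nabla f$ for all $f\in C_c^\infty(\Omega,\mathbb R)$), and such that $A_\lambda:=F_\lambda^{-1}dF_\lambda$ equals $$A_\lambda=\lambda^{-2}A_2'+\lambda^{-1}A_{-1}+A_0+\lambda A_1+\lambda^2A_2'',$$ where $A=F^{-1}dF=\sum_aA_a$ with $A_a$ valued in $\mathfrak{u}(3)^{\mathbb C}_a$, and $A_2'$, $A_2''$ are the $dz$- and $d\bar z$-parts of $A_2$. For $n\in\mathbb N$ let $\Lambda^{n}\mathfrak{u}(3)$ be the space of loops $\xi_\lambda=\sum_{|k|\le n}\hat\xi_k\lambda^k$ with values in $\mathfrak{u}(3)$ for $\lambda\in S^1$, and $\Lambda^{n}\mathfrak{u}(3)_\tau$ the subspace of those with $\tau(\xi_\lambda)=\xi_{i\lambda}$. Let $\mathfrak b\subset\mathfrak{u}(3)_0^{\mathbb C}\cong\mathfrak{sl}(2,\mathbb C)$ be the lower triangular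 trace-free matrices with real diagonal, and $(\cdot)_{\mathfrak{su}}$ the projection of $\mathfrak{sl}(2,\mathbb C)=\mathfrak{su}(2)\oplus\mathfrak b$ onto $\mathfrak{su}(2)\cong\mathfrak u(3)_0$. For Laurent polynomial loops put $$(\xi_\lambda)_{\Lambda\mathfrak{su}}=\sum_{k<0}\hat\xi_k\lambda^k+(\hat\xi_0)_{\mathfrak{su}}-\sum_{k<0}\hat\xi_{k}^\dagger\lambda^{-k},\qquad (\xi_\lambda)_\Omega=\sum_{k<0}\big(\hat\xi_k(\lambda^k-1)-\hat\xi_k^\dagger(\lambda^{-k}-1)\big),$$ applied to loop-valued one-forms on each real tangent vector. A family $F_\lambda$ is of *finite type* if there are $p\in\mathbb{N}$ and a smooth $\xi_\lambda:\Omega\to\Lambda^{2+4p}\mathfrak{u}(3)_\tau$ with $\hat\xi_{-4p-2}=\mathrm{diag}(ia,ia,0)$ for a constant $a\in\mathbb{C}$, with $$d\xi_\lambda=[\xi_\lambda,A_\lambda]\quad(1)\qquad\text{and}\qquad(\lambda^{4p}\xi_\lambda dz)_{\Lambda\mathfrak{su}}=A_\lambda\quad(2);$$ it is of *quasi-finite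 type* if the same holds with (2) replaced by $$(\lambda^{4p}\xi_\lambda dz)_{\Lambda\mathfrak{su}}=A_\lambda+B\quad(2')$$ for some one-form $B$ on $\Omega$ with coefficients in $\mathfrak{u}(3)_0^{\mathbb C}$. The based loop map $E_\lambda:=F_\lambda F^{-1}$ is of *finite type* if, with $\Gamma_\lambda:=E_\lambda^{-1}dE_\lambda$, there are $p\in\mathbb N$ and a smooth $\eta_\lambda:\Omega\to\Lambda^{2+4p}\mathfrak{u}(3)$ with $d\eta_\lambda+[\Gamma_\lambda,\eta_\lambda]=0$ and $\Gamma_\lambda=(\lambda^{4p}\eta_\lambda dz)_\Omega$. **Theorem.** Let $F_\lambda$ be a family of Hamiltonian stationary conformal Lagrangian immersions on $\Omega$. (i) Let $p\in\mathbb{N}$ and let $\xi_\lambda:\Omega\to\Lambda^{2+4p}\mathfrak{u}(3)_\tau$ be smooth and satisfy (1) and (2') for some $B$. Then there is $G\in C^\infty(\Omega,U(3)_0)$ with $G(z_0)=\mathrm{Id}$ such that the family $F_\lambda^G:=F_\lambda G$ is of finite type. More precisely, put $A_\lambda^G:=G^{-1}A_\lambda G+G^{-1}dG$, which is $(F^G_\lambda)^{-1}dF^G_\lambda$,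 and $\xi_\lambda^G:=G^{-1}\xi_\lambda G$. Then $\xi^G_\lambda$ is a smooth map into $\Lambda^{2+4p}\mathfrak u(3)_\tau$, its coefficient of $\lambda^{-4p-2}$ is $\mathrm{diag}(ia,ia,0)$ for a constant $a\in\mathbb C$, and $$d\xi_\lambda^G+[A_\lambda^G,\xi_\lambda^G]=G^{-1}\big(d\xi_\lambda+[A_\lambda,\xi_\lambda]\big)G=0,\qquad(\lambda^{4p}\xi_\lambda^Gdz)_{\Lambda\mathfrak{su}}=A_\lambda^G .$$ (ii) The following are equivalent: $F_\lambda$ is of quasi-finite type; $F_\lambda G$ is of finite type for some $G\in C^\infty(\Omega,U(3)_0)$; $E_\lambda=F_\lambda F^{-1}$ is of finite type. -/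

import Mathlib

open scoped Matrix Matrix.Norms.Operator LaurentPolynomial ContDiff

noncomputable section

namespace HamStat

/-- `u(3)^ℂ = gl(3, ℂ)`; `u(3)` consists of the matrices with `Mᴴ = -M`.
(Smoothness and derivatives do not depend on the norm chosen on this finite-dimensional space.) -/
abbrev M3 : Type := Matrix (Fin 3) (Fin 3) ℂ

/-! ### The automorphism of order four -/

/-- The block matrix `diag(J, 1)`, `J = (0, -1; 1, 0)`. -/
def Jp : M3 := !![0, -1, 0; 1, 0, 0; 0, 0, 1]

/-- The block matrix `diag(-J, 1)`. -/
def Jm : M3 := !![0, 1, 0; -1, 0, 0; 0, 0, 1]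

/-- `τ` on the Lie algebra `u(3)^ℂ`. -/
def tau (M : M3) : M3 := -(Jm * Mᵀ * Jp)

theorem tau_eq (M : M3) : tau M =
    !![-M 1 1, M 0 1, -M 2 1; M 1 0, -M 0 0, M 2 0; -M 1 2, M 0 2, -M 2 2] := by
  ext i j
  simp only [tau, Matrix.neg_apply, Matrix.mul_apply, Fin.sum_univ_three, Matrix.transpose_apply]
  fin_cases i <;> fin_cases j <;> simp [Jm, Jp]

/-- `τ` on the group `U(3)^ℂ = GL(3, ℂ)`. -/
def tauGrp (g : M3) : M3 := Jm * (gᵀ)⁻¹ * Jp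

/-- The eigenspace `u(3)^ℂ_a` of `τ`, for the eigenvalue `i ^ a`. -/
def uC (a : ℤ) : Set M3 := {M | tau M = Complex.I ^ a • M}

/-- The component of `M` in `u(3)^ℂ_a`, i.e. the projection `(1/4) ∑ j, i ^ (-a j) τ ^ j` onto the
eigenspace. -/
def tauComp (a : ℤ) (M : M3) : M3 :=
  (1 / 4 : ℂ) • ∑ j ∈ Finset.range 4, Complex.I ^ (-a * (j : ℤ)) • tau^[j] M

/-- `U(3)_0 ≅ SU(2)`, the matrices `diag(g, 1)` with `g ∈ SU(2)`. The elements of `U(3)` fixed by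
`τ` are the `diag(g, ±1)` with `g ∈ SU(2)`; the last condition selects the copy of `SU(2)`. -/
def U30 : Set M3 := {g | g ∈ Matrix.unitaryGroup (Fin 3) ℂ ∧ tauGrp g = g ∧ g 2 2 = 1}

/-- The complex number `i` as an element of the unit circle. -/
def circleI : Circle := ⟨Complex.I, by simp [Submonoid.unitSphere]⟩

/-! ### Laurent polynomial loops -/

/-- Loops `λ ↦ ∑ ξ̂_k λ ^ k` in `u(3)^ℂ` with finitely many Fourier coefficients. -/
abbrev Loop : Type := LaurentPolynomial M3

/-- The value of a loop at `l ∈ S¹`. -/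
def Loop.evalAt (ξ : Loop) (l : Circle) : M3 := ξ.coeff.sum fun k m => (l : ℂ) ^ k • m

/-- `Λ^n u(3)`: loops in `u(3)` with Fourier modes in `[-n, n]`. -/
def LoopU (n : ℕ) : Set Loop :=
  {ξ | (∀ k : ℤ, (n : ℤ) < |k| → ξ.coeff k = 0) ∧ ∀ l, (ξ.evalAt l)ᴴ = -ξ.evalAt l}

/-- `Λ^n u(3)_τ`: the twisted loops in `Λ^n u(3)`. -/
def LoopUTau (n : ℕ) : Set Loop :=
  {ξ | ξ ∈ LoopU n ∧ ∀ l, tau (ξ.evalAt l) = ξ.evalAt (circleI * l)}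

/-- The Lie algebra `𝔟` of lower triangular `2 × 2` matrices with real diagonal and zero trace,
inside `u(3)^ℂ_0 ≅ sl(2, ℂ)`. -/
def borel : Set M3 := {M | ∃ (t : ℝ) (c : ℂ), M = !![(t : ℂ), 0, 0; c, -(t : ℂ), 0; 0, 0, 0]}

/-- The projection `u(3)^ℂ_0 → u(3)_0` along `𝔟`, for the splitting
`sl(2, ℂ) = su(2) ⊕ 𝔟`. -/
def suPart (M : M3) : M3 :=
  !![((M 0 0).im : ℂ) * Complex.I, M 0 1, 0;
    -star (M 0 1), -(((M 0 0).im : ℂ) * Complex.I), 0;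
    0, 0, 0]

theorem suPart_mem {M : M3} (h : M ∈ uC 0) :
    suPart M ∈ uC 0 ∧ (suPart M)ᴴ = -suPart M ∧ M - suPart M ∈ borel := by
  have h' : tau M = M := by simpa [uC] using h
  have e : ∀ i j, tau M i j = M i j := fun i j => by rw [h']
  simp [tau_eq, Fin.forall_fin_succ] at e
  refine ⟨?_, ?_, (M 0 0).re, M 1 0 + star (M 0 1), ?_⟩
  · suffices tau (suPart M) = suPart M by simpa [uC] using this
    ext i j
    fin_cases i <;> fin_cases j <;> simp [suPart, tau_eq]
  · ext i j
    fin_cases i <;> fin_cases j <;> simp [suPart]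
  · have r : (M 0 0) = (M 0 0).re + (M 0 0).im * Complex.I := (Complex.re_add_im _).symm
    ext i j
    fin_cases i <;> fin_cases j <;> simp [suPart] <;> grind

/-- The projection `(·)_{Λsu}` onto `Λ u(3)_τ` along the loops `∑_{k ≥ 0} ξ̂_k λ ^ k` with
`ξ̂_0 ∈ 𝔟`:
`ξ ↦ ∑_{k < 0} ξ̂_k λ ^ k + (ξ̂_0)_su - ∑_{k < 0} (ξ̂_k)† λ ^ (-k)`. -/
def Loop.projSu (ξ : Loop) : Loop :=
  LaurentPolynomial.C (suPart (ξ.coeff 0)) +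
    ∑ k ∈ ξ.coeff.support with k < 0,
      (AddMonoidAlgebra.single k (ξ.coeff k) - AddMonoidAlgebra.single (-k) (ξ.coeff k)ᴴ)

/-- The projection `(·)_Ω` onto the based loop algebra along `Λ⁺ u(3)^ℂ`:
`ξ ↦ ∑_{k < 0} (ξ̂_k (λ ^ k - 1) - (ξ̂_k)† (λ ^ (-k) - 1))`. -/
def Loop.projBased (ξ : Loop) : Loop :=
  ∑ k ∈ ξ.coeff.support with k < 0,
    ((AddMonoidAlgebra.single k (ξ.coeff k) - LaurentPolynomial.C (ξ.coeff k)) -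
      (AddMonoidAlgebra.single (-k) (ξ.coeff k)ᴴ - LaurentPolynomial.C (ξ.coeff k)ᴴ))

/-- A map from `Ω` to loops is smooth if all its Fourier coefficients are. -/
def SmoothLoop (Ω : Set ℂ) (ξ : ℂ → Loop) : Prop :=
  ∀ k : ℤ, ContDiffOn ℝ ∞ (fun z => (ξ z).coeff k) Ω

/-! ### Maurer--Cartan forms and their deformation.
One-forms are written as `θ z v`, with `z` the point and `v ∈ ℂ` the tangent vector;
`dz` is `v ↦ v`. -/

/-- The Maurer--Cartan form `f⁻¹ · df`. -/
def mc (f : ℂ → M3) (z v : ℂ) : M3 := (f z)⁻¹ * fderiv ℝ f z v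

/-- The `(1,0)`-part `θ(∂/∂z) dz` of a real-linear form. -/
def part10 (θ : ℂ → M3) (v : ℂ) : M3 := v • (1 / 2 : ℂ) • (θ 1 - Complex.I • θ Complex.I)

/-- The `(0,1)`-part `θ(∂/∂z̄) dz̄` of a real-linear form. -/
def part01 (θ : ℂ → M3) (v : ℂ) : M3 :=
  star v • (1 / 2 : ℂ) • (θ 1 + Complex.I • θ Complex.I)

/-- The deformation
`A_λ = λ⁻² A_2' + λ⁻¹ A_{-1} + A_0 + λ A_1 + λ² A_2''` of a `u(3)`-valued form `A`. -/
def deform (A : ℂ → M3) (l : Circle) (v : ℂ) : M3 :=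
  (l : ℂ) ^ (-2 : ℤ) • part10 (fun w => tauComp 2 (A w)) v
    + (l : ℂ) ^ (-1 : ℤ) • tauComp (-1) (A v)
    + tauComp 0 (A v)
    + (l : ℂ) • tauComp 1 (A v)
    + (l : ℂ) ^ 2 • part01 (fun w => tauComp 2 (A w)) v

/-! ### Hamiltonian stationary conformal Lagrangian immersions into `ℂP²`.
A Lagrangian immersion `u : Ω → ℂP²` is given through a horizontal (parallel) lift
`û : Ω → S⁵ ⊂ ℂ³`. As the Hopf map is isometric on horizontal vectors, `û` computes the
metric and the Kähler form along `u`. -/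

/-- The Hermitian product of `ℂ³`. -/
def herm (a b : Fin 3 → ℂ) : ℂ := star a ⬝ᵥ b

/-- The partial derivative `∂/∂x`. -/
def dX {E : Type*} [NormedAddCommGroup E] [NormedSpace ℝ E] (f : ℂ → E) (z : ℂ) : E :=
  fderiv ℝ f z 1

/-- The partial derivative `∂/∂y`. -/
def dY {E : Type*} [NormedAddCommGroup E] [NormedSpace ℝ E] (f : ℂ → E) (z : ℂ) : E :=
  fderiv ℝ f z Complex.I

/-- `û : Ω → S⁵` is a horizontal lift of a conformal Lagrangian immersion `u : Ω → ℂP²`. -/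
structure IsConformalLagrangianLift (Ω : Set ℂ) (u : ℂ → Fin 3 → ℂ) : Prop where
  smooth : ContDiffOn ℝ ∞ u Ω
  sphere : ∀ z ∈ Ω, herm (u z) (u z) = 1
  horizontal : ∀ z ∈ Ω, herm (u z) (dX u z) = 0 ∧ herm (u z) (dY u z) = 0
  immersion : ∀ z ∈ Ω, herm (dX u z) (dX u z) ≠ 0
  conformal : ∀ z ∈ Ω, herm (dX u z) (dX u z) = herm (dY u z) (dY u z) ∧
    (herm (dX u z) (dY u z)).re = 0
  lagrangian : ∀ z ∈ Ω, (herm (dX u z) (dY u z)).im = 0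

/-- The horizontal lift of the Hamiltonian vector field `J ∇f` along a conformal Lagrangian
immersion; the gradient is taken in the induced metric `|∂u/∂x|² (dx² + dy²)`. -/
def hamField (u : ℂ → Fin 3 → ℂ) (f : ℂ → ℝ) (z : ℂ) : Fin 3 → ℂ :=
  (Complex.I * (herm (dX u z) (dX u z))⁻¹) •
    (((dX f z : ℝ) : ℂ) • dX u z + ((dY f z : ℝ) : ℂ) • dY u z)

/-- The first variation of the area in the direction of every Hamiltonian field `J ∇f`, with `f`
smooth and compactly supported in `Ω`, vanishes. In conformal coordinates the first variation
along `V` is `∫ (⟨∂V/∂x, ∂u/∂x⟩ + ⟨∂V/∂y, ∂u/∂y⟩) dx dy`. -/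
def IsHamiltonianStationary (Ω : Set ℂ) (u : ℂ → Fin 3 → ℂ) : Prop :=
  ∀ f : ℂ → ℝ, ContDiff ℝ ∞ f → HasCompactSupport f → tsupport f ⊆ Ω →
    ∫ z in Ω, ((herm (dX (hamField u f) z) (dX u z)).re
      + (herm (dY (hamField u f) z) (dY u z)).re) = 0

/-- The value `e^{iβ} = det(e₁, e₂, û)` of the Lagrangian angle function, where `e₁, e₂` are the
normalized partial derivatives of the conformal immersion. -/
def expAngle (u : ℂ → Fin 3 → ℂ) (z : ℂ) : ℂ :=
  (herm (dX u z) (dX u z))⁻¹ *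
    Matrix.det (Matrix.of fun i j => ![dX u z i, dY u z i, u z i] j : M3)

/-- `F` is a Legendrian framing of `u` along `û`: its last column is `û`, and
`det F = e^{iβ}`. -/
structure IsLegendrianFraming (Ω : Set ℂ) (F : ℂ → M3) (u : ℂ → Fin 3 → ℂ) : Prop where
  smooth : ContDiffOn ℝ ∞ F Ω
  unitary : ∀ z ∈ Ω, F z ∈ Matrix.unitaryGroup (Fin 3) ℂ
  column : ∀ z ∈ Ω, ∀ i, F z i 2 = u z i
  det : ∀ z ∈ Ω, (F z).det = expAngle u z

/-- `F_λ : Ω → Λ U(3)_τ` is a family of Hamiltonian stationary conformal Lagrangian immersions: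
`F_{λ=1}` is a Legendrian framing of such an immersion, and the Maurer--Cartan form of `F_λ` is the
deformation of that of `F_{λ=1}`. -/
structure IsFamily (Ω : Set ℂ) (F : Circle → ℂ → M3) : Prop where
  smooth : ∀ l, ContDiffOn ℝ ∞ (F l) Ω
  unitary : ∀ l, ∀ z ∈ Ω, F l z ∈ Matrix.unitaryGroup (Fin 3) ℂ
  twisted : ∀ l, ∀ z ∈ Ω, tauGrp (F l z) = F (circleI * l) z
  framing : ∃ u, IsConformalLagrangianLift Ω u ∧ IsHamiltonianStationary Ω u ∧
    IsLegendrianFraming Ω (F 1) u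
  deformation : ∀ l, ∀ z ∈ Ω, ∀ v, mc (F l) z v = deform (mc (F 1) z) l v

/-! ### Finite type and quasi-finite type -/

/-- The Lax equation `dξ_λ = [ξ_λ, A_λ]`. -/
def Lax (Ω : Set ℂ) (ξ : ℂ → Loop) (A : Circle → ℂ → ℂ → M3) : Prop :=
  ∀ l, ∀ z ∈ Ω, ∀ v, fderiv ℝ (fun w => (ξ w).evalAt l) z v = ⁅(ξ z).evalAt l, A l z v⁆

/-- The loop `λ^{4p} ξ_λ dz`, evaluated on the tangent vector `v`. -/
def shifted (p : ℕ) (ξ : Loop) (v : ℂ) : Loop :=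
  v • (LaurentPolynomial.T (4 * (p : ℤ)) * ξ)

/-- `ξ : Ω → Λ^{2+4p} u(3)_τ` is smooth, satisfies the Lax equation for `A_λ = F_λ⁻¹ dF_λ` and
`(λ^{4p} ξ_λ dz)_{Λsu} = A_λ + B` for a one-form `B` with coefficients in `u(3)^ℂ_0`. -/
structure IsQuasiAdapted (Ω : Set ℂ) (F : Circle → ℂ → M3) (p : ℕ) (ξ : ℂ → Loop) : Prop where
  mem : ∀ z ∈ Ω, ξ z ∈ LoopUTau (2 + 4 * p)
  smooth : SmoothLoop Ω ξ
  lax : Lax Ω ξ fun l => mc (F l)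
  adapted : ∃ B : ℂ → ℂ →L[ℝ] M3, (∀ z ∈ Ω, ∀ v, B z v ∈ uC 0) ∧
    ∀ l, ∀ z ∈ Ω, ∀ v, (shifted p (ξ z) v).projSu.evalAt l = mc (F l) z v + B z v

/-- `ξ : Ω → Λ^{2+4p} u(3)_τ` is smooth, satisfies the Lax equation for `A_λ = F_λ⁻¹ dF_λ` and
`(λ^{4p} ξ_λ dz)_{Λsu} = A_λ`. -/
structure IsAdapted (Ω : Set ℂ) (F : Circle → ℂ → M3) (p : ℕ) (ξ : ℂ → Loop) : Prop where
  mem : ∀ z ∈ Ω, ξ z ∈ LoopUTau (2 + 4 * p)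
  smooth : SmoothLoop Ω ξ
  lax : Lax Ω ξ fun l => mc (F l)
  adapted : ∀ l, ∀ z ∈ Ω, ∀ v, (shifted p (ξ z) v).projSu.evalAt l = mc (F l) z v

/-- The lowest coefficient `ξ̂_{-4p-2}` is constant, of the form `diag(ia, ia, 0)`. -/
def HasConstLeading (Ω : Set ℂ) (p : ℕ) (ξ : ℂ → Loop) : Prop :=
  ∃ a : ℂ, ∀ z ∈ Ω, (ξ z).coeff (-4 * (p : ℤ) - 2) =
    Matrix.diagonal ![Complex.I * a, Complex.I * a, 0]

/-- Families of finite type. -/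
def IsFiniteType (Ω : Set ℂ) (F : Circle → ℂ → M3) : Prop :=
  IsFamily Ω F ∧ ∃ p ξ, HasConstLeading Ω p ξ ∧ IsAdapted Ω F p ξ

/-- Families of quasi-finite type. -/
def IsQuasiFiniteType (Ω : Set ℂ) (F : Circle → ℂ → M3) : Prop :=
  IsFamily Ω F ∧ ∃ p ξ, HasConstLeading Ω p ξ ∧ IsQuasiAdapted Ω F p ξ

/-- The based loop map `E_λ = F_λ · F_{λ=1}⁻¹`. -/
def based (F : Circle → ℂ → M3) (l : Circle) (z : ℂ) : M3 := F l z * (F 1 z)⁻¹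

/-- Finite type in terms of based loops: `Γ_λ = E_λ⁻¹ dE_λ` satisfies
`dη_λ + [Γ_λ, η_λ] = 0` and `Γ_λ = (λ^{4p} η_λ dz)_Ω` for some `p` and some smooth
`η : Ω → Λ^{2+4p} u(3)`. -/
def IsBasedFiniteType (Ω : Set ℂ) (E : Circle → ℂ → M3) : Prop :=
  ∃ (p : ℕ) (η : ℂ → Loop), (∀ z ∈ Ω, η z ∈ LoopU (2 + 4 * p)) ∧ SmoothLoop Ω η ∧
    (Lax Ω η fun l => mc (E l)) ∧
    ∀ l, ∀ z ∈ Ω, ∀ v, mc (E l) z v = (shifted p (η z) v).projBased.evalAt l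

/-! ### Gauge transformations -/

/-- `G ∈ C^∞(Ω, U(3)_0)`. -/
def IsGauge (Ω : Set ℂ) (G : ℂ → M3) : Prop :=
  ContDiffOn ℝ ∞ G Ω ∧ ∀ z ∈ Ω, G z ∈ U30

/-- `F_λ^G = F_λ · G`. -/
def gaugeF (F : Circle → ℂ → M3) (G : ℂ → M3) (l : Circle) (z : ℂ) : M3 := F l z * G z

/-- `A^G = G⁻¹ · A · G + G⁻¹ · dG`. -/
def gaugeA (A : Circle → ℂ → ℂ → M3) (G : ℂ → M3) (l : Circle) (z v : ℂ) : M3 :=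
  (G z)⁻¹ * A l z v * G z + (G z)⁻¹ * fderiv ℝ G z v

/-- `ξ^G = G⁻¹ · ξ · G`. -/
def gaugeLoop (ξ : ℂ → Loop) (G : ℂ → M3) (z : ℂ) : Loop :=
  LaurentPolynomial.C (G z)⁻¹ * ξ z * LaurentPolynomial.C (G z)

end HamStat

end

open HamStat

/-!
Write `ξ̂_k` for the coefficients of `ξ_λ`. Each of (2) and (2') says that the coefficients of `λ⁻²`
and `λ⁻¹` in `λ^{4p} ξ_λ dz` are those of `A_λ`. For (2') this is everything; (2) says in addition
that the form `θ = A_0 - ξ̂_{-4p} dz` takes values in `𝔟`.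

The Lax equation at `λ^{-4p}` and the `u(3)^ℂ_0`-part of the structure equation for `A` show that
`θ` is flat: the multiples of `dz ∧ dz` vanish, `u(3)^ℂ_2` is commutative, and the two commutators
of `ξ̂_{-4p-1}` with its adjoint cancel. As `Ω` is simply connected, `dK = -θ K`, `K(z₀) = 1`, has a
solution with values in `SL(2, ℂ)`. If `K = G B` is its Iwasawa factorization, then
`G⁻¹ θ G + G⁻¹ dG = B d(B⁻¹)` takes values in `𝔟`, so that gauging by `G` turns (2') into (2).

Conjugation by `F` turns polynomial Killing fields for `Γ_λ` into polynomial Killing fields for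
`A_λ` that satisfy the condition on the coefficients of `λ⁻²` and `λ⁻¹`, but are not necessarily
twisted. Averaging over the automorphism `ξ_λ ↦ τ⁻¹(ξ_{iλ})` of order four makes them twisted and
preserves this condition.
-/

noncomputable section

namespace HamStat

section FlatConnection

open Filter Topology Set Metric
open scoped NNReal

variable {E F 𝔸 : Type*} [NormedAddCommGroup E] [NormedSpace ℝ E]
  [NormedAddCommGroup F] [NormedSpace ℝ F] [NormedRing 𝔸] [NormedAlgebra ℝ 𝔸]

/-- The zero-curvature condition for the equation `dK = α K`, where the one-form `α` has values in
an associative algebra. -/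
def IsFlatOn (α : E → E →L[ℝ] 𝔸) (U : Set E) : Prop :=
  ∀ z ∈ U, ∀ u v, fderiv ℝ α z u v + α z v * α z u = fderiv ℝ α z v u + α z u * α z v

/-- A parallel frame of the connection form `α` on `U`: an invertible solution of `dK = α K`. -/
def IsFrameOn (α : E → E →L[ℝ] 𝔸) (K : E → 𝔸) (U : Set E) : Prop :=
  ∀ z ∈ U, IsUnit (K z) ∧ HasFDerivAt K ((ContinuousLinearMap.mul ℝ 𝔸).flip (K z) ∘L α z) z

/-- A quantitative form of being `C^{1,1}`: a common bound `M` for the map, its derivative, and the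
Lipschitz constant of its derivative. -/
structure HasC11BoundOn (f : E → F) (M : ℝ≥0) (s : Set E) : Prop where
  differentiableAt : ∀ z ∈ s, DifferentiableAt ℝ f z
  norm_le : ∀ z ∈ s, ‖f z‖ ≤ M
  norm_fderiv_le : ∀ z ∈ s, ‖fderiv ℝ f z‖ ≤ M
  lipschitz : LipschitzOnWith M (fderiv ℝ f) s

theorem HasC11BoundOn.mono {f : E → F} {M : ℝ≥0} {s t : Set E} (hf : HasC11BoundOn f M t)
    (h : s ⊆ t) : HasC11BoundOn f M s :=
  ⟨fun z hz => hf.differentiableAt z (h hz), fun z hz => hf.norm_le z (h hz),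
    fun z hz => hf.norm_fderiv_le z (h hz), hf.lipschitz.mono h⟩

theorem exists_hasC11BoundOn_ball {f : E → F} {c : E} (hf : ContDiffAt ℝ 2 f c) :
    ∃ M : ℝ≥0, ∃ ρ > 0, HasC11BoundOn f M (ball c ρ) := by
  have hf' : ContDiffAt ℝ 1 (fderiv ℝ f) c := hf.fderiv_right (by norm_num)
  obtain ⟨L, s, hs, hL⟩ := hf'.exists_lipschitzOnWith
  have hfM : ∀ᶠ z in 𝓝 c, ‖f z‖₊ < ‖f c‖₊ + 1 :=
    hf.continuousAt.nnnorm.eventually (gt_mem_nhds (lt_add_one _))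
  have hf'M : ∀ᶠ z in 𝓝 c, ‖fderiv ℝ f z‖₊ < ‖fderiv ℝ f c‖₊ + 1 :=
    (ContinuousAt.nnnorm (E := E →L[ℝ] F) hf'.continuousAt).eventually
      (gt_mem_nhds (lt_add_one _))
  have hdiff : ∀ᶠ z in 𝓝 c, DifferentiableAt ℝ f z :=
    (hf.eventually (by simp)).mono fun z hz => hz.differentiableAt two_ne_zero
  obtain ⟨ρ, hρ, hball⟩ := Metric.eventually_nhds_iff_ball.1
    (((hfM.and hf'M).and hdiff).and hs)
  refine ⟨L + (‖f c‖₊ + 1) + (‖fderiv ℝ f c‖₊ + 1), ρ, hρ, fun z hz => (hball z hz).1.2,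
    fun z hz => ?_, fun z hz => ?_, (hL.mono fun z hz => (hball z hz).2).weaken ?_⟩
  · exact_mod_cast (hball z hz).1.1.1.le.trans (le_add_right le_add_self)
  · exact_mod_cast (hball z hz).1.1.2.le.trans le_add_self
  · exact le_add_right le_self_add

theorem HasC11BoundOn.norm_sub_sub_fderiv_le {f : E → F} {M : ℝ≥0} {s : Set E}
    (hf : HasC11BoundOn f M s) (hs : Convex ℝ s) {x y : E} (hx : x ∈ s) (hy : y ∈ s) :
    ‖f y - f x - fderiv ℝ f x (y - x)‖ ≤ M * ‖y - x‖ ^ 2 := by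
  have hseg : segment ℝ x y ⊆ s := hs.segment_subset hx hy
  rw [sq, ← mul_assoc]
  refine (convex_segment x y).norm_image_sub_le_of_norm_hasFDerivWithin_le' (f' := fderiv ℝ f)
    (fun z hz => (hf.differentiableAt z (hseg hz)).hasFDerivAt.hasFDerivWithinAt)
    (fun z hz => (hf.lipschitz.norm_sub_le (hseg hz) hx).trans ?_) (left_mem_segment ℝ x y)
    (right_mem_segment ℝ x y)
  gcongr
  exact norm_sub_le_of_mem_segment hz

theorem HasC11BoundOn.norm_sub_le {f : E → F} {M : ℝ≥0} {s : Set E}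
    (hf : HasC11BoundOn f M s) (hs : Convex ℝ s) {x y : E} (hx : x ∈ s) (hy : y ∈ s) :
    ‖f y - f x‖ ≤ M * ‖y - x‖ :=
  hs.norm_image_sub_le_of_norm_fderiv_le hf.differentiableAt hf.norm_fderiv_le hx hy

/-- If `k` solves `k' = α(c + t w)(w) k`, this bounds the defect of `(1 + t α(c + t w)(h)) k` as a
solution of the equation along the neighbouring ray in the direction `w + h`. Flatness is what
cancels the terms linear in `h`. -/
theorem norm_ray_defect_le {α : E → E →L[ℝ] 𝔸} {M : ℝ≥0} {s : Set E}
    (hα : HasC11BoundOn α M s) (hs : Convex ℝ s) (hflat : IsFlatOn α s) {w h z : E} {t : ℝ}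
    (ht : |t| ≤ 1) (hw : ‖w‖ ≤ 1) (hwh : ‖w + h‖ ≤ 1) (hz : z ∈ s) (hz' : z + t • h ∈ s) :
    ‖α z h + t • fderiv ℝ α z w h + (1 + t • α z h) * α z w
        - α (z + t • h) (w + h) * (1 + t • α z h)‖ ≤ (2 * M + 2 * M ^ 2) * ‖h‖ ^ 2 := by
  set z' := z + t • h
  have hth : ‖z' - z‖ ≤ ‖h‖ := by
    simpa only [z', add_sub_cancel_left, norm_smul, Real.norm_eq_abs] using
      mul_le_of_le_one_left (norm_nonneg h) ht
  have htaylor : ‖(α z' - α z - fderiv ℝ α z (t • h)) w‖ ≤ M * ‖h‖ ^ 2 := by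
    refine (ContinuousLinearMap.unit_le_opNorm _ w hw).trans ?_
    have h2 := hα.norm_sub_sub_fderiv_le hs hz hz'
    rw [show z' - z = t • h from add_sub_cancel_left z _] at h2 hth
    exact h2.trans (by gcongr)
  have hlip : ‖α z' - α z‖ ≤ M * ‖h‖ := (hα.norm_sub_le hs hz hz').trans (by gcongr)
  have hαh : ‖α z h‖ ≤ M * ‖h‖ := (α z).le_of_opNorm_le (hα.norm_le z hz) h
  have hlip_h : ‖(α z' - α z) h‖ ≤ M * ‖h‖ * ‖h‖ := (α z' - α z).le_of_opNorm_le hlip h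
  have hlip_wh : ‖(α z' - α z) (w + h)‖ ≤ M * ‖h‖ :=
    (ContinuousLinearMap.unit_le_opNorm _ _ hwh).trans hlip
  have hmul : ‖t • (((α z' - α z) (w + h) + α z h) * α z h)‖ ≤
      (M * ‖h‖ + M * ‖h‖) * (M * ‖h‖) := by
    rw [norm_smul]
    refine (mul_le_of_le_one_left (norm_nonneg _) ht).trans ((norm_mul_le _ _).trans ?_)
    gcongr
    exact norm_add_le_of_le hlip_wh hαh
  have hsplit : α z h + t • fderiv ℝ α z w h + (1 + t • α z h) * α z w
        - α z' (w + h) * (1 + t • α z h)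
      = -((α z' - α z - fderiv ℝ α z (t • h)) w + (α z' - α z) h
        + t • (((α z' - α z) (w + h) + α z h) * α z h)) := by
    have hcurv : fderiv ℝ α z w h = fderiv ℝ α z h w + α z w * α z h - α z h * α z w :=
      eq_sub_of_add_eq (hflat z hz w h)
    simp only [hcurv, map_add, map_smul, sub_apply, smul_apply, mul_add, add_mul, sub_mul, mul_one,
      one_mul, smul_add, smul_sub, smul_mul_assoc, mul_smul_comm]
    abel
  rw [hsplit, norm_neg]
  exact (norm_add_le_of_le (norm_add_le_of_le htaylor hlip_h) hmul).trans_eq (by ring)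

theorem gronwallBound_zero_left (K ε x : ℝ) :
    gronwallBound 0 K ε x = gronwallBound 0 K 1 x * ε := by
  by_cases hK : K = 0
  · simp [hK, gronwallBound_K0, mul_comm]
  · simp only [gronwallBound_of_K_ne_0 hK]
    ring

theorem add_smul_mem_ball {c w : E} {r : ℝ} (hw : w ∈ ball (0 : E) r) {t : ℝ}
    (ht : t ∈ Icc (0 : ℝ) 1) : c + t • w ∈ ball c r := by
  rw [mem_ball_iff_norm, add_sub_cancel_left, norm_smul, Real.norm_of_nonneg ht.1]
  exact (mul_le_of_le_one_left (norm_nonneg _) ht.2).trans_lt (mem_ball_zero_iff.1 hw)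

/-- The solution of `dK = α K` along the ray from `c` to `c + w`, parametrized by `[0, 1]`. -/
structure IsRaySolution (α : E → E →L[ℝ] 𝔸) (c w : E) (k : ℝ → 𝔸) : Prop where
  zero : k 0 = 1
  hasDerivWithinAt : ∀ t ∈ Icc (0 : ℝ) 1, HasDerivWithinAt k (α (c + t • w) w * k t) (Icc 0 1) t

theorem IsRaySolution.continuousOn {α : E → E →L[ℝ] 𝔸} {c w : E} {k : ℝ → 𝔸}
    (hk : IsRaySolution α c w k) : ContinuousOn k (Icc 0 1) :=
  fun t ht => (hk.hasDerivWithinAt t ht).continuousWithinAt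

theorem IsRaySolution.hasDerivWithinAt_Ici {α : E → E →L[ℝ] 𝔸} {c w : E} {k : ℝ → 𝔸}
    (hk : IsRaySolution α c w k) {t : ℝ} (ht : t ∈ Ico (0 : ℝ) 1) :
    HasDerivWithinAt k (α (c + t • w) w * k t) (Ici t) t :=
  (hk.hasDerivWithinAt t (Ico_subset_Icc_self ht)).mono_of_mem_nhdsWithin (Icc_mem_nhdsGE_of_mem ht)

theorem IsRaySolution.hasDerivWithinAt_one_add_smul_mul {α : E → E →L[ℝ] 𝔸} {c w h : E}
    {k : ℝ → 𝔸} (hk : IsRaySolution α c w k) {t : ℝ} (ht : t ∈ Icc (0 : ℝ) 1)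
    (hα : DifferentiableAt ℝ α (c + t • w)) :
    HasDerivWithinAt (fun t => (1 + t • α (c + t • w) h) * k t)
      ((α (c + t • w) h + t • fderiv ℝ α (c + t • w) w h + (1 + t • α (c + t • w) h) *
        α (c + t • w) w) * k t) (Icc 0 1) t := by
  have hray : HasDerivAt (fun t : ℝ => c + t • w) w t := by
    simpa using ((hasDerivAt_id t).smul_const w).const_add c
  have hαh : HasDerivAt (fun t : ℝ => α (c + t • w) h) (fderiv ℝ α (c + t • w) w h) t :=
    (ContinuousLinearMap.apply ℝ 𝔸 h).hasFDerivAt.comp_hasDerivAt t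
      (hα.hasFDerivAt.comp_hasDerivAt t hray)
  refine ((((hasDerivAt_id t).smul hαh).const_add 1).hasDerivWithinAt.mul
    (hk.hasDerivWithinAt t ht)).congr_deriv ?_
  simp only [id, one_smul, Pi.smul_apply', add_mul, mul_assoc]
  abel

theorem IsRaySolution.eq_one {α : E → E →L[ℝ] 𝔸} {c : E} {k : ℝ → 𝔸}
    (hk : IsRaySolution α c 0 k) : k 1 = 1 :=
  (constant_of_has_deriv_right_zero hk.continuousOn
    (fun _ ht => (hk.hasDerivWithinAt_Ici ht).congr_deriv (by simp)) 1 (by simp)).trans hk.zero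

theorem IsRaySolution.norm_sub_sub_le {α : E → E →L[ℝ] 𝔸} {M : ℝ≥0} {c : E} {r N : ℝ}
    (hα : HasC11BoundOn α M (ball c r)) (hflat : IsFlatOn α (ball c r)) (hr : r ≤ 1)
    {w h : E} (hw : w ∈ ball 0 r) (hwh : w + h ∈ ball 0 r) {k k' : ℝ → 𝔸}
    (hk : IsRaySolution α c w k) (hk' : IsRaySolution α c (w + h) k')
    (hkN : ∀ t ∈ Icc (0 : ℝ) 1, ‖k t‖ ≤ N) :
    ‖k' 1 - k 1 - α (c + w) h * k 1‖ ≤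
      gronwallBound 0 M ((2 * M + 2 * M ^ 2) * ‖h‖ ^ 2 * N) 1 := by
  have hw1 : ‖w‖ ≤ 1 := (mem_ball_zero_iff.1 hw).le.trans hr
  have hwh1 : ‖w + h‖ ≤ 1 := (mem_ball_zero_iff.1 hwh).le.trans hr
  set q : ℝ → 𝔸 := fun t => (1 + t • α (c + t • w) h) * k t with hq
  have hq' := fun (t : ℝ) (ht : t ∈ Icc (0 : ℝ) 1) =>
    hk.hasDerivWithinAt_one_add_smul_mul (h := h) ht
      (hα.differentiableAt _ (add_smul_mem_ball hw ht))
  have hdefect : ∀ t ∈ Ico (0 : ℝ) 1, dist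
      ((α (c + t • w) h + t • fderiv ℝ α (c + t • w) w h + (1 + t • α (c + t • w) h) *
        α (c + t • w) w) * k t) (α (c + t • (w + h)) (w + h) * q t)
      ≤ (2 * M + 2 * M ^ 2) * ‖h‖ ^ 2 * N := fun t ht => by
    have ht' : t ∈ Icc (0 : ℝ) 1 := Ico_subset_Icc_self ht
    have hz' := add_smul_mem_ball (c := c) hwh ht'
    rw [smul_add, ← add_assoc] at hz' ⊢
    rw [dist_eq_norm, hq, ← mul_assoc, ← sub_mul]
    refine (norm_mul_le _ _).trans (mul_le_mul ?_ (hkN t ht') (norm_nonneg _) (by positivity))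
    exact norm_ray_defect_le hα (convex_ball c r) hflat (abs_le.2 ⟨by linarith [ht.1], ht.2.le⟩)
      hw1 hwh1 (add_smul_mem_ball hw ht') hz'
  have hgronwall := dist_le_of_approx_trajectories_ODE_of_mem (δ := 0) (εf := 0) (K := M)
    (v := fun t x => α (c + t • (w + h)) (w + h) * x) (s := fun _ => univ) (fun t ht => ?_)
    hk'.continuousOn (fun t ht => hk'.hasDerivWithinAt_Ici ht) (fun t _ => (dist_self _).le)
    (fun _ _ => mem_univ _) (fun t ht => (hq' t ht).continuousWithinAt)
    (fun t ht => (hq' t (Ico_subset_Icc_self ht)).mono_of_mem_nhdsWithin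
      (Icc_mem_nhdsGE_of_mem ht)) hdefect (fun _ _ => mem_univ _)
    (by simp [hk.zero, hk'.zero]) 1 (right_mem_Icc.2 zero_le_one)
  · simpa [hq, dist_eq_norm, add_mul, sub_sub] using hgronwall
  · refine LipschitzOnWith.of_dist_le_mul fun x _ y _ => ?_
    rw [dist_eq_norm, dist_eq_norm, ← mul_sub]
    refine (norm_mul_le _ _).trans ?_
    gcongr
    exact (ContinuousLinearMap.unit_le_opNorm _ _ hwh1).trans
      (hα.norm_le _ (add_smul_mem_ball hwh (Ico_subset_Icc_self ht)))

theorem exists_hasDerivWithinAt_mul_Icc [CompleteSpace 𝔸] {a : ℝ → 𝔸} {C : ℝ}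
    (ha : ContinuousOn a (Icc 0 1)) (haC : ∀ t ∈ Icc (0 : ℝ) 1, ‖a t‖ ≤ C)
    (hC : C * (‖(1 : 𝔸)‖ + 1) ≤ 1) :
    ∃ k : ℝ → 𝔸, k 0 = 1 ∧
      (∀ t ∈ Icc (0 : ℝ) 1, HasDerivWithinAt k (a t * k t) (Icc 0 1) t) ∧
      ∀ t ∈ Icc (0 : ℝ) 1, ‖k t‖ ≤ ‖(1 : 𝔸)‖ * Real.exp C := by
  have hC0 : 0 ≤ C := (norm_nonneg _).trans (haC 0 (by simp))
  have hpl : IsPicardLindelof (fun t x => a t * x) (tmin := 0) (tmax := 1) ⟨0, by simp⟩ (1 : 𝔸)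
      1 0 1 C.toNNReal := by
    refine ⟨fun t ht => ?_, fun x _ => ha.mul continuousOn_const, fun t ht x hx => ?_, by simp⟩
    · refine LipschitzOnWith.of_dist_le_mul fun x _ y _ => ?_
      rw [dist_eq_norm, dist_eq_norm, ← mul_sub, Real.coe_toNNReal _ hC0]
      exact (norm_mul_le _ _).trans (by gcongr; exact haC t ht)
    · have hx' : ‖x‖ ≤ ‖(1 : 𝔸)‖ + 1 := norm_le_of_mem_closedBall hx
      exact (norm_mul_le _ _).trans (le_trans (by gcongr; exact haC t ht) hC)
  obtain ⟨k, hk0, hk⟩ := hpl.exists_eq_forall_mem_Icc_hasDerivWithinAt₀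
  refine ⟨k, hk0, hk, fun t ht => ?_⟩
  have hgronwall := norm_le_gronwallBound_of_norm_deriv_right_le (δ := ‖(1 : 𝔸)‖) (K := C) (ε := 0)
    (fun t ht => (hk t ht).continuousWithinAt)
    (fun t ht => (hk t (Ico_subset_Icc_self ht)).mono_of_mem_nhdsWithin (Icc_mem_nhdsGE_of_mem ht))
    (by rw [← hk0]) (fun s hs => ?_) t ht
  · rw [gronwallBound_ε0, sub_zero] at hgronwall
    refine hgronwall.trans ?_
    gcongr
    exact mul_le_of_le_one_right hC0 ht.2
  · rw [add_zero]
    exact (norm_mul_le _ _).trans (by gcongr; exact haC s (Ico_subset_Icc_self hs))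

theorem exists_isRaySolution [CompleteSpace 𝔸] {α : E → E →L[ℝ] 𝔸} {M : ℝ≥0} {c w : E} {r : ℝ}
    (hα : HasC11BoundOn α M (ball c r)) (hr : M * r * (‖(1 : 𝔸)‖ + 1) ≤ 1)
    (hw : w ∈ ball 0 r) :
    ∃ k, IsRaySolution α c w k ∧
      ∀ t ∈ Icc (0 : ℝ) 1, ‖k t‖ ≤ ‖(1 : 𝔸)‖ * Real.exp (M * r) := by
  have hcont : ContinuousOn (fun t : ℝ => α (c + t • w) w) (Icc 0 1) := fun t ht => by
    have hαt : ContinuousAt (fun t : ℝ => α (c + t • w)) t := ContinuousAt.comp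
      (f := fun t : ℝ => c + t • w) (hα.differentiableAt _ (add_smul_mem_ball hw ht)).continuousAt
      (by fun_prop)
    exact (hαt.clm_apply continuousAt_const).continuousWithinAt
  obtain ⟨k, hk0, hk, hkN⟩ := exists_hasDerivWithinAt_mul_Icc hcont (fun t ht =>
    (ContinuousLinearMap.le_of_opNorm_le_of_le _ (hα.norm_le _ (add_smul_mem_ball hw ht))
      (mem_ball_zero_iff.1 hw).le)) hr
  exact ⟨k, ⟨hk0, hk⟩, hkN⟩

theorem hasFDerivAt_ray_endpoint {α : E → E →L[ℝ] 𝔸} {M : ℝ≥0} {c : E} {r N : ℝ}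
    (hα : HasC11BoundOn α M (ball c r)) (hflat : IsFlatOn α (ball c r)) (hr : r ≤ 1)
    {k : E → ℝ → 𝔸} (hk : ∀ w ∈ ball 0 r, IsRaySolution α c w (k w))
    (hkN : ∀ w ∈ ball 0 r, ∀ t ∈ Icc (0 : ℝ) 1, ‖k w t‖ ≤ N) {z : E} (hz : z ∈ ball c r) :
    HasFDerivAt (fun z => k (z - c) 1)
      ((ContinuousLinearMap.mul ℝ 𝔸).flip (k (z - c) 1) ∘L α z) z := by
  have hzc : z - c ∈ ball (0 : E) r := by rwa [mem_ball_zero_iff, ← mem_ball_iff_norm]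
  have hnear : ∀ᶠ h in 𝓝 (0 : E), z - c + h ∈ ball (0 : E) r :=
    (continuous_const_add (z - c)).continuousAt.eventually_mem
      (isOpen_ball.mem_nhds (by rwa [add_zero]))
  rw [hasFDerivAt_iff_isLittleO_nhds_zero]
  refine (Asymptotics.IsBigO.of_bound (gronwallBound 0 M 1 1 * ((2 * M + 2 * M ^ 2) * N))
    ?_).trans_isLittleO (by simpa using Asymptotics.isLittleO_norm_pow_id (E' := E) one_lt_two)
  filter_upwards [hnear] with h hh
  have hest := (hk _ hzc).norm_sub_sub_le hα hflat hr hzc hh (hk _ hh) (hkN _ hzc)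
  rw [gronwallBound_zero_left, add_sub_cancel, sub_add_eq_add_sub] at hest
  simp only [ContinuousLinearMap.comp_apply, ContinuousLinearMap.flip_apply,
    ContinuousLinearMap.mul_apply', norm_pow, norm_norm]
  exact hest.trans_eq (by ring)

theorem exists_isFrameOn_nhds [CompleteSpace 𝔸] {α : E → E →L[ℝ] 𝔸} {U : Set E} (hU : IsOpen U)
    (hα : ContDiffOn ℝ 2 α U) (hflat : IsFlatOn α U) {c : E} (hc : c ∈ U) :
    ∃ V, IsOpen V ∧ c ∈ V ∧ V ⊆ U ∧ ∃ K, IsFrameOn α K V := by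
  obtain ⟨M, ρ, hρ, hM⟩ := exists_hasC11BoundOn_ball (hα.contDiffAt (hU.mem_nhds hc))
  obtain ⟨ρ', hρ', hρU⟩ := Metric.isOpen_iff.1 hU c hc
  obtain ⟨r, hr0, hr⟩ : ∃ r > 0, r ≤ min (min ρ ρ') (min 1 (((M + 1) * (‖(1 : 𝔸)‖ + 1))⁻¹)) :=
    ⟨_, by positivity, le_rfl⟩
  simp only [le_min_iff] at hr
  obtain ⟨⟨hrρ, hrρ'⟩, hr1, hrM⟩ := hr
  have hsmall : M * r * (‖(1 : 𝔸)‖ + 1) ≤ 1 := by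
    rw [← one_div, le_div_iff₀ (by positivity)] at hrM
    nlinarith [norm_nonneg (1 : 𝔸)]
  have hMr : HasC11BoundOn α M (ball c r) := hM.mono (ball_subset_ball hrρ)
  have hrU : ball c r ⊆ U := (ball_subset_ball hrρ').trans hρU
  choose! k hk hkN using fun w hw => exists_isRaySolution (w := w) hMr hsmall hw
  let K : E → 𝔸 := fun z => k (z - c) 1
  have hKd := fun z (hz : z ∈ ball c r) =>
    hasFDerivAt_ray_endpoint hMr (fun z hz => hflat z (hrU hz)) hr1 hk hkN hz
  have hKc : K c = 1 := by
    simpa only [K, sub_self] using (hk 0 (mem_ball_self hr0)).eq_one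
  have hKcont : ContinuousOn K (ball c r) := fun z hz => (hKd z hz).continuousAt.continuousWithinAt
  exact ⟨ball c r ∩ K ⁻¹' {x | IsUnit x}, hKcont.isOpen_inter_preimage isOpen_ball Units.isOpen,
    ⟨mem_ball_self hr0, by simp [hKc]⟩, fun z hz => hrU hz.1, K, fun z hz => ⟨hz.2, hKd z hz.1⟩⟩

end FlatConnection

section LocallyConstantCocycle

open Filter Topology

variable {X 𝒢 : Type*} [TopologicalSpace X] [Group 𝒢]

/-- The principal bundle with discrete fibre `𝒢` whose transition functions are the quotients
`(φ j)⁻¹ φ i` of local functions `φ i` on the sets `U i ∋ i`; its sections are the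
continuations of these functions. -/
def cocycleBundleCore [TopologicalSpace 𝒢] [DiscreteTopology 𝒢] {U : X → Set X}
    (hU : ∀ x, IsOpen (U x)) (hxU : ∀ x, x ∈ U x) (φ : X → X → 𝒢)
    (hφ : ∀ i j, ∀ x ∈ U i ∩ U j, ∀ᶠ y in 𝓝 x, (φ j y)⁻¹ * φ i y = (φ j x)⁻¹ * φ i x) :
    FiberBundleCore X X 𝒢 where
  baseSet := U
  isOpen_baseSet := hU
  indexAt := id
  mem_baseSet_at := hxU
  coordChange i j x g := (φ j x)⁻¹ * φ i x * g
  coordChange_self i x _ g := by simp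
  continuousOn_coordChange := by
    rintro i j ⟨x, g⟩ ⟨hx, -⟩
    have hconst : ContinuousAt (fun p : X × 𝒢 => (φ j x)⁻¹ * φ i x * p.2) (x, g) :=
      (continuous_of_discreteTopology (f := ((φ j x)⁻¹ * φ i x * ·))).continuousAt.comp
        continuousAt_snd
    refine (hconst.congr ?_).continuousWithinAt
    filter_upwards [(continuousAt_fst (p := (x, g))).eventually (hφ i j x hx)] with p hp
    rw [hp]
  coordChange_comp i j k x _ g := by group

theorem exists_forall_eventually_eq_mul_of_cocycle [SimplyConnectedSpace X]
    [LocallyPathConnectedSpace X] {U : X → Set X} (hU : ∀ x, IsOpen (U x)) (hxU : ∀ x, x ∈ U x)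
    (φ : X → X → 𝒢)
    (hφ : ∀ i j, ∀ x ∈ U i ∩ U j, ∀ᶠ y in 𝓝 x, (φ j y)⁻¹ * φ i y = (φ j x)⁻¹ * φ i x)
    (x₀ : X) (g₀ : 𝒢) :
    ∃ s : X → 𝒢, s x₀ = g₀ ∧ ∀ x, ∃ g, ∀ᶠ y in 𝓝 x, s y = φ x y * g := by
  let _ : TopologicalSpace 𝒢 := ⊥
  have : DiscreteTopology 𝒢 := ⟨rfl⟩
  let Z := cocycleBundleCore hU hxU φ hφ
  have hcov : IsCoveringMap (Bundle.TotalSpace.proj : Z.TotalSpace → X) :=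
    FiberBundle.isCoveringMap
  obtain ⟨S, ⟨hS₀, hS⟩, -⟩ := hcov.existsUnique_continuousMap_lifts (ContinuousMap.id X) x₀
    (⟨x₀, (φ x₀ x₀)⁻¹ * g₀⟩ : Z.TotalSpace) rfl
  have hproj : ∀ x, (S x).proj = x := congrFun hS
  let f : X → 𝒢 := fun x => (S x).2
  have hcoord : ∀ x y, (Z.localTriv x (S y)).2 = (φ x y)⁻¹ * (φ y y * f y) := fun x y => by
    change (φ x (S y).proj)⁻¹ * φ (S y).proj (S y).proj * f y = _
    rw [hproj, mul_assoc]
  refine ⟨fun x => φ x x * f x, ?_, fun x => ⟨f x, ?_⟩⟩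
  · have hf₀ : f x₀ = (φ x₀ x₀)⁻¹ * g₀ := by simp only [f]; rw [hS₀]
    simp [hf₀]
  have hcont : ContinuousAt (fun y => (Z.localTriv x (S y)).2) x := by
    refine continuousAt_snd.comp
      (ContinuousAt.comp (g := Z.localTriv x) ?_ S.continuous.continuousAt)
    refine (Z.localTriv x).continuousOn.continuousAt ((Z.localTriv x).open_source.mem_nhds ?_)
    rw [(Z.localTriv x).mem_source]
    exact (congrArg (· ∈ U x) (hproj x)).mpr (hxU x)
  filter_upwards [hcont.eventually ((isOpen_discrete {(Z.localTriv x (S x)).2}).mem_nhds rfl)]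
    with y hy
  have hy' : (Z.localTriv x (S y)).2 = (Z.localTriv x (S x)).2 := hy
  rwa [hcoord, hcoord, inv_mul_cancel_left, inv_mul_eq_iff_eq_mul] at hy'

end LocallyConstantCocycle

section GlobalFrame

open Filter Topology Set Metric

variable {E 𝔸 : Type*} [NormedAddCommGroup E] [NormedSpace ℝ E]
  [NormedRing 𝔸] [NormedAlgebra ℝ 𝔸] {α : E → E →L[ℝ] 𝔸} {K K' : E → 𝔸} {U V : Set E}

theorem IsFrameOn.mono (hK : IsFrameOn α K U) (h : V ⊆ U) : IsFrameOn α K V :=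
  fun z hz => hK z (h hz)

theorem IsFrameOn.eventually_inverse_mul_eq [CompleteSpace 𝔸] (hV : IsOpen V)
    (hK : IsFrameOn α K V) (hK' : IsFrameOn α K' V) {c : E} (hc : c ∈ V) :
    ∀ᶠ z in 𝓝 c, Ring.inverse (K z) * K' z = Ring.inverse (K c) * K' c := by
  have hd : ∀ z ∈ V, HasFDerivAt (fun z => Ring.inverse (K z) * K' z) (0 : E →L[ℝ] 𝔸) z := by
    intro z hz
    obtain ⟨⟨u, hu⟩, hKz⟩ := hK z hz
    have hinv := hasFDerivAt_ringInverse (𝕜 := ℝ) u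
    rw [hu] at hinv
    refine ((hinv.comp z hKz).mul' (hK' z hz).2).congr_fderiv ?_
    ext v
    simp [← hu, mul_assoc]
  obtain ⟨ρ, hρ, hρV⟩ := Metric.isOpen_iff.1 hV c hc
  filter_upwards [ball_mem_nhds c hρ] with z hz
  exact (convex_ball c ρ).is_const_of_fderivWithin_eq_zero (𝕜 := ℝ)
    (f := fun z => Ring.inverse (K z) * K' z)
    (fun x hx => (hd x (hρV hx)).differentiableAt.differentiableWithinAt)
    (fun x hx => ((hd x (hρV hx)).hasFDerivWithinAt.fderivWithin
      (isOpen_ball.uniqueDiffWithinAt hx))) hz (mem_ball_self hρ)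

theorem IsFrameOn.contDiffOn (hU : IsOpen U) (hα : ContDiffOn ℝ ∞ α U) (hK : IsFrameOn α K U) :
    ContDiffOn ℝ ∞ K U := by
  rw [contDiffOn_infty]
  intro n
  induction n with
  | zero => exact contDiffOn_zero.2 fun z hz => (hK z hz).2.continuousAt.continuousWithinAt
  | succ n ih =>
    rw [Nat.cast_add, Nat.cast_one, contDiffOn_succ_iff_fderiv_of_isOpen hU]
    refine ⟨fun z hz => (hK z hz).2.differentiableAt.differentiableWithinAt, by simp,
      ContDiffOn.congr ?_ fun z hz => (hK z hz).2.fderiv⟩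
    exact ((ContinuousLinearMap.mul ℝ 𝔸).flip.contDiff.comp_contDiffOn ih).clm_comp
      (hα.of_le (by exact_mod_cast le_top))

theorem isFrameOn_of_eventually_eq_mul (h : ∀ z ∈ U, ∃ V k, ∃ g : 𝔸ˣ,
    z ∈ V ∧ IsFrameOn α k V ∧ ∀ᶠ y in 𝓝 z, K y = k y * g) : IsFrameOn α K U := by
  intro z hz
  obtain ⟨V, k, g, hzV, hk, hKk⟩ := h z hz
  obtain ⟨hunit, hkz⟩ := hk z hzV
  have hKz : K z = k z * g := hKk.self_of_nhds
  refine ⟨hKz ▸ hunit.mul g.isUnit,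
    ((hkz.mul_const' (g : 𝔸)).congr_of_eventuallyEq hKk).congr_fderiv ?_⟩
  ext v
  simp [hKz, mul_assoc]

theorem exists_isFrameOn [CompleteSpace 𝔸] (hU : IsOpen U) (hsc : IsSimplyConnected U)
    (hα : ContDiffOn ℝ 2 α U) (hflat : IsFlatOn α U) {c : E} (hc : c ∈ U) :
    ∃ K : E → 𝔸, K c = 1 ∧ IsFrameOn α K U := by
  classical
  have := hsc.simplyConnectedSpace
  have := hU.locallyPathConnectedSpace
  choose V hVo hxV hVU k hk using fun x : U => exists_isFrameOn_nhds hU hα hflat x.2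
  let φ : U → U → 𝔸ˣ := fun i x => if h : IsUnit (k i x) then h.unit else 1
  have hφ : ∀ i x : U, (x : E) ∈ V i → (φ i x : 𝔸) = k i x := fun i x hx => by
    simp [φ, dif_pos (hk i x hx).1]
  have hcocycle : ∀ i j : U, ∀ x ∈ (↑) ⁻¹' V i ∩ (↑) ⁻¹' V j,
      ∀ᶠ y in 𝓝 x, (φ j y)⁻¹ * φ i y = (φ j x)⁻¹ * φ i x := fun i j x hx => by
    have hopen : IsOpen (V i ∩ V j) := (hVo i).inter (hVo j)
    have hquot := ((hk j).mono inter_subset_right).eventually_inverse_mul_eq hopen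
      ((hk i).mono inter_subset_left) hx
    filter_upwards [(continuous_subtype_val.continuousAt (x := x)).eventually
      (hquot.and (hopen.mem_nhds hx))] with y ⟨hy, hyi, hyj⟩
    rw [← hφ i y hyi, ← hφ j y hyj, ← hφ i x hx.1, ← hφ j x hx.2, Ring.inverse_unit,
      Ring.inverse_unit] at hy
    exact_mod_cast hy
  obtain ⟨s, hs₀, hs⟩ := exists_forall_eventually_eq_mul_of_cocycle
    (fun i => (hVo i).preimage continuous_subtype_val) hxV φ hcocycle ⟨c, hc⟩ 1
  let K : E → 𝔸 := fun z => if h : z ∈ U then (s ⟨z, h⟩ : 𝔸) else 1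
  have hK : ∀ x : U, K x = s x := fun x => by simp [K]
  refine ⟨K, by simp [hK ⟨c, hc⟩, hs₀], isFrameOn_of_eventually_eq_mul fun z hz => ?_⟩
  obtain ⟨g, hg⟩ := hs ⟨z, hz⟩
  refine ⟨V ⟨z, hz⟩, k ⟨z, hz⟩, g, hxV ⟨z, hz⟩, hk _, ?_⟩
  rw [nhds_subtype_eq_comap, eventually_comap] at hg
  filter_upwards [hg, (hVo ⟨z, hz⟩).mem_nhds (hxV ⟨z, hz⟩)] with y hy hyV
  rw [hK ⟨y, hVU _ hyV⟩, hy ⟨y, hVU _ hyV⟩ rfl, Units.val_mul, hφ _ ⟨y, hVU _ hyV⟩ hyV]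

theorem exists_frame_of_linearMap [FiniteDimensional ℝ E] [CompleteSpace 𝔸]
    {θ : E → E →ₗ[ℝ] 𝔸} (hU : IsOpen U) (hsc : IsSimplyConnected U)
    (hθ : ∀ v, ContDiffOn ℝ ∞ (fun z => θ z v) U)
    (hflat : ∀ z ∈ U, ∀ u v, fderiv ℝ (fun w => θ w v) z u + θ z v * θ z u =
      fderiv ℝ (fun w => θ w u) z v + θ z u * θ z v) {c : E} (hc : c ∈ U) :
    ∃ K : E → 𝔸, K c = 1 ∧ ContDiffOn ℝ ∞ K U ∧
      ∀ z ∈ U, IsUnit (K z) ∧ ∀ v, fderiv ℝ K z v = θ z v * K z := by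
  let α : E → E →L[ℝ] 𝔸 := fun z => (θ z).toContinuousLinearMap
  have hα : ContDiffOn ℝ ∞ α U := contDiffOn_clm_apply.2 hθ
  have hα' : ∀ z ∈ U, ∀ u v, fderiv ℝ α z u v = fderiv ℝ (fun w => θ w v) z u :=
    fun z hz u v => by
      have hdα := (hα.contDiffAt (hU.mem_nhds hz)).differentiableAt (by simp)
      have happly := fderiv_clm_apply hdα (differentiableAt_const v)
      rw [show (fun w => θ w v) = fun w => α w v from rfl, happly]
      simp
  obtain ⟨K, hKc, hK⟩ := exists_isFrameOn hU hsc (hα.of_le (by norm_cast))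
    (fun z hz u v => by rw [hα' z hz, hα' z hz]; exact hflat z hz u v) hc
  exact ⟨K, hKc, hK.contDiffOn hU hα, fun z hz =>
    ⟨(hK z hz).1, fun v => DFunLike.congr_fun (hK z hz).2.fderiv v⟩⟩

end GlobalFrame

section Automorphism

theorem Jm_mul_Jp : Jm * Jp = 1 := by
  ext i j
  fin_cases i <;> fin_cases j <;> simp [Jm, Jp, Matrix.mul_apply, Fin.sum_univ_three]

theorem Jp_mul_Jm : Jp * Jm = 1 := mul_eq_one_comm.1 Jm_mul_Jp

/-- `τ` on the Lie algebra, as a linear map. -/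
def tauLin : M3 →ₗ[ℂ] M3 where
  toFun := tau
  map_add' M N := by simp only [tau, Matrix.transpose_add, mul_add, add_mul, neg_add]
  map_smul' c M := by simp [tau]

theorem tau_add (M N : M3) : tau (M + N) = tau M + tau N := tauLin.map_add M N

theorem tau_smul (c : ℂ) (M : M3) : tau (c • M) = c • tau M := tauLin.map_smul c M

theorem tau_tau_tau_tau (M : M3) : tau (tau (tau (tau M))) = M := by
  ext i j
  fin_cases i <;> fin_cases j <;> simp [tau_eq]

theorem tau_conjTranspose (M : M3) : tau Mᴴ = (tau M)ᴴ := by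
  ext i j
  fin_cases i <;> fin_cases j <;> simp [tau_eq]

theorem tau_mul (M N : M3) : tau (M * N) = -(tau N * tau M) := by
  simp only [tau, Matrix.transpose_mul, neg_mul_neg, neg_inj]
  calc Jm * (Nᵀ * Mᵀ) * Jp = Jm * Nᵀ * 1 * Mᵀ * Jp := by simp only [mul_assoc, one_mul]
    _ = Jm * Nᵀ * Jp * (Jm * Mᵀ * Jp) := by rw [← Jp_mul_Jm]; simp only [mul_assoc]

theorem tau_lie (M N : M3) : tau ⁅M, N⁆ = ⁅tau M, tau N⁆ := by
  simp only [Ring.lie_def]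
  rw [show tau (M * N - N * M) = tau (M * N) - tau (N * M) from tauLin.map_sub _ _, tau_mul,
    tau_mul]
  abel

theorem tau_inv (g : M3) : tau g⁻¹ = -tauGrp g := by
  rw [tau, tauGrp, Matrix.transpose_nonsing_inv]

theorem tauGrp_mul (g h : M3) : tauGrp (g * h) = tauGrp g * tauGrp h := by
  rw [← neg_inj, ← tau_inv, Matrix.mul_inv_rev, tau_mul, tau_inv, tau_inv, neg_mul_neg]

theorem I_zpow_eq_of_dvd {a b : ℤ} (h : (4 : ℤ) ∣ b - a) : Complex.I ^ b = Complex.I ^ a := by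
  have hmod : a ≡ b [ZMOD 4] := Int.modEq_iff_dvd.2 h
  rw [Complex.I_zpow_eq_zpow_mod b, ← hmod, ← Complex.I_zpow_eq_zpow_mod]

theorem star_I_zpow (a : ℤ) : star (Complex.I ^ a) = Complex.I ^ (-a) := by
  rw [zpow_neg, star_zpow₀, ← inv_zpow]
  simp

end Automorphism

section Eigenspaces

variable {a b : ℤ} {M N : M3}

/-- `u(3)^ℂ_a` as a linear subspace. -/
def uCSubmodule (a : ℤ) : Submodule ℂ M3 := Module.End.eigenspace tauLin (Complex.I ^ a)

theorem mem_uC_iff : M ∈ uC a ↔ tau M = Complex.I ^ a • M := Iff.rfl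

theorem mem_uCSubmodule_iff : M ∈ uCSubmodule a ↔ M ∈ uC a := Module.End.mem_eigenspace_iff

theorem smul_mem_uC (c : ℂ) (hM : M ∈ uC a) : c • M ∈ uC a :=
  mem_uCSubmodule_iff.1 ((uCSubmodule a).smul_mem c (mem_uCSubmodule_iff.2 hM))

theorem add_mem_uC (hM : M ∈ uC a) (hN : N ∈ uC a) : M + N ∈ uC a :=
  mem_uCSubmodule_iff.1 ((uCSubmodule a).add_mem (mem_uCSubmodule_iff.2 hM)
    (mem_uCSubmodule_iff.2 hN))

theorem neg_mem_uC (hM : M ∈ uC a) : -M ∈ uC a :=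
  mem_uCSubmodule_iff.1 ((uCSubmodule a).neg_mem (mem_uCSubmodule_iff.2 hM))

theorem sub_mem_uC (hM : M ∈ uC a) (hN : N ∈ uC a) : M - N ∈ uC a :=
  mem_uCSubmodule_iff.1 ((uCSubmodule a).sub_mem (mem_uCSubmodule_iff.2 hM)
    (mem_uCSubmodule_iff.2 hN))

theorem conjTranspose_mem_uC (hM : M ∈ uC a) : Mᴴ ∈ uC (-a) := by
  rw [mem_uC_iff] at *
  rw [tau_conjTranspose, hM, Matrix.conjTranspose_smul, star_I_zpow]

theorem uC_eq_of_dvd (h : (4 : ℤ) ∣ b - a) : uC b = uC a := by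
  simp only [uC, I_zpow_eq_of_dvd h]

theorem tau_iterate_of_mem_uC (hM : M ∈ uC b) (j : ℕ) :
    tau^[j] M = (Complex.I ^ b) ^ j • M := by
  induction j with
  | zero => simp
  | succ j ih =>
    rw [Function.iterate_succ_apply', ih, tau_smul, mem_uC_iff.1 hM, smul_smul, pow_succ]

theorem I_zpow_neg_mul_mul_pow (a b : ℤ) (j : ℕ) :
    Complex.I ^ (-a * (j : ℤ)) * (Complex.I ^ b) ^ j = (Complex.I ^ (b - a)) ^ j := by
  rw [zpow_mul, zpow_natCast, ← mul_pow, ← zpow_add₀ Complex.I_ne_zero, neg_add_eq_sub]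

theorem tauComp_of_mem_uC (hM : M ∈ uC b) : tauComp a M = if (4 : ℤ) ∣ b - a then M else 0 := by
  set x := Complex.I ^ (b - a)
  have hsum : tauComp a M = (1 / 4 : ℂ) • (∑ j ∈ Finset.range 4, x ^ j) • M := by
    rw [tauComp, Finset.sum_smul]
    refine congrArg _ (Finset.sum_congr rfl fun j _ => ?_)
    rw [tau_iterate_of_mem_uC hM, smul_smul, I_zpow_neg_mul_mul_pow]
  have hx : x = 1 ↔ (4 : ℤ) ∣ b - a := Complex.isPrimitiveRoot_I.zpow_eq_one_iff_dvd _
  split_ifs with hdvd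
  · rw [hsum, hx.2 hdvd]
    simp
  · have hx4 : x ^ 4 = 1 := by
      rw [← zpow_natCast, ← zpow_mul, mul_comm, zpow_mul, zpow_natCast, Complex.I_pow_four,
        one_zpow]
    have hgeom := geom_sum_mul x 4
    rw [hx4, sub_self, mul_eq_zero, or_iff_left (sub_ne_zero.2 (mt hx.1 hdvd))] at hgeom
    simp [hsum, hgeom]

theorem tauComp_eq (a : ℤ) (M : M3) : tauComp a M = (1 / 4 : ℂ) •
    (M + Complex.I ^ (-a) • tau M + Complex.I ^ (-(2 * a)) • tau (tau M)
      + Complex.I ^ (-(3 * a)) • tau (tau (tau M))) := by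
  simp [tauComp, Finset.sum_range_succ, mul_comm]

theorem tauComp_mem (a : ℤ) (M : M3) : tauComp a M ∈ uC a := by
  have hI := Complex.I_ne_zero
  have h1 : Complex.I ^ a * Complex.I ^ (-a) = 1 := by
    rw [← zpow_add₀ hI, add_neg_cancel, zpow_zero]
  have h2 : Complex.I ^ a * Complex.I ^ (-(2 * a)) = Complex.I ^ (-a) := by
    rw [← zpow_add₀ hI]; congr 1; ring
  have h3 : Complex.I ^ a * Complex.I ^ (-(3 * a)) = Complex.I ^ (-(2 * a)) := by
    rw [← zpow_add₀ hI]; congr 1; ring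
  have h4 : Complex.I ^ (-(3 * a)) = Complex.I ^ a := I_zpow_eq_of_dvd (by omega)
  rw [mem_uC_iff, tauComp_eq, tau_smul, smul_comm (Complex.I ^ a)]
  simp only [tau_add, tau_smul, tau_tau_tau_tau, smul_add, smul_smul, h1, h2, h3, one_smul]
  rw [h4]
  abel

/-- The projection onto `u(3)^ℂ_a` as a linear map. -/
def tauCompLin (a : ℤ) : M3 →ₗ[ℂ] M3 where
  toFun := tauComp a
  map_add' M N := by simp only [tauComp_eq, tau_add, smul_add]; abel
  map_smul' c M := by simp only [tauComp_eq, tau_smul, smul_add, RingHom.id_apply, smul_comm c]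

theorem tauComp_add (a : ℤ) (M N : M3) : tauComp a (M + N) = tauComp a M + tauComp a N :=
  (tauCompLin a).map_add M N

theorem tauComp_sub (a : ℤ) (M N : M3) : tauComp a (M - N) = tauComp a M - tauComp a N :=
  (tauCompLin a).map_sub M N

theorem tauComp_neg (a : ℤ) (M : M3) : tauComp a (-M) = -tauComp a M :=
  (tauCompLin a).map_neg M

theorem tauComp_smul (a : ℤ) (c : ℂ) (M : M3) : tauComp a (c • M) = c • tauComp a M :=
  (tauCompLin a).map_smul c M

theorem tauComp_eq_of_dvd (h : (4 : ℤ) ∣ b - a) (M : M3) : tauComp b M = tauComp a M := by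
  simp only [tauComp_eq, I_zpow_eq_of_dvd (show (4 : ℤ) ∣ -b - -a by omega),
    I_zpow_eq_of_dvd (show (4 : ℤ) ∣ -(2 * b) - -(2 * a) by omega),
    I_zpow_eq_of_dvd (show (4 : ℤ) ∣ -(3 * b) - -(3 * a) by omega)]

theorem tauComp_conjTranspose (a : ℤ) (M : M3) : (tauComp a M)ᴴ = tauComp (-a) Mᴴ := by
  simp only [tauComp_eq, Matrix.conjTranspose_smul, Matrix.conjTranspose_add, star_I_zpow,
    tau_conjTranspose, mul_neg]
  simp

theorem tauComp_sum (M : M3) :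
    tauComp 2 M + tauComp (-1) M + tauComp 0 M + tauComp 1 M = M := by
  have h2 : Complex.I ^ 2 = -1 := Complex.I_sq
  have h3 : Complex.I ^ 3 = -Complex.I := Complex.I_pow_three
  have hn4 : Complex.I ^ (-4 : ℤ) = Complex.I ^ (0 : ℤ) := I_zpow_eq_of_dvd (by norm_num)
  have hn6 : Complex.I ^ (-6 : ℤ) = Complex.I ^ (2 : ℤ) := I_zpow_eq_of_dvd (by norm_num)
  have hn2 : Complex.I ^ (-2 : ℤ) = Complex.I ^ (2 : ℤ) := I_zpow_eq_of_dvd (by norm_num)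
  have hn3 : Complex.I ^ (-3 : ℤ) = Complex.I ^ (1 : ℤ) := I_zpow_eq_of_dvd (by norm_num)
  norm_num [tauComp_eq, hn2, hn3, hn4, hn6, zpow_ofNat, h2, h3]
  module

theorem tau_iterate_lie_of_mem_uC (hN : N ∈ uC b) (M : M3) (j : ℕ) :
    tau^[j] ⁅M, N⁆ = (Complex.I ^ b) ^ j • ⁅tau^[j] M, N⁆ := by
  induction j with
  | zero => simp
  | succ j ih =>
    rw [Function.iterate_succ_apply', Function.iterate_succ_apply', ih, tau_smul, tau_lie,
      mem_uC_iff.1 hN, Ring.lie_def, Ring.lie_def, mul_smul_comm, smul_mul_assoc, ← smul_sub,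
      smul_smul, pow_succ]

theorem tauComp_lie_of_mem_uC (hN : N ∈ uC b) (a : ℤ) (M : M3) :
    tauComp a ⁅M, N⁆ = ⁅tauComp (a - b) M, N⁆ := by
  have hcoeff : ∀ j : ℕ, Complex.I ^ (-a * (j : ℤ)) * (Complex.I ^ b) ^ j
      = Complex.I ^ (-(a - b) * (j : ℤ)) := fun j => by
    rw [I_zpow_neg_mul_mul_pow, neg_sub, zpow_mul, zpow_natCast]
  simp only [tauComp, tau_iterate_lie_of_mem_uC hN, smul_smul, hcoeff]
  simp only [Ring.lie_def, smul_mul_assoc, mul_smul_comm, Finset.sum_mul, Finset.mul_sum,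
    ← smul_sub, ← Finset.sum_sub_distrib]

theorem ring_add_lie {R : Type*} [NonUnitalNonAssocRing R] (x y z : R) :
    ⁅x + y, z⁆ = ⁅x, z⁆ + ⁅y, z⁆ := by
  simp only [Ring.lie_def, add_mul, mul_add]
  abel

theorem ring_lie_add {R : Type*} [NonUnitalNonAssocRing R] (x y z : R) :
    ⁅x, y + z⁆ = ⁅x, y⁆ + ⁅x, z⁆ := by
  simp only [Ring.lie_def, add_mul, mul_add]
  abel

theorem tauComp_zero_lie (M N : M3) : tauComp 0 ⁅M, N⁆ = ⁅tauComp 2 M, tauComp 2 N⁆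
    + ⁅tauComp 1 M, tauComp (-1) N⁆ + ⁅tauComp 0 M, tauComp 0 N⁆
    + ⁅tauComp (-1) M, tauComp 1 N⁆ := by
  conv_lhs => rw [← tauComp_sum N]
  simp only [ring_lie_add, tauComp_add, tauComp_lie_of_mem_uC (tauComp_mem _ N)]
  rw [tauComp_eq_of_dvd (a := 2) (b := 0 - 2) (by norm_num)]
  norm_num

theorem eq_of_mem_uC_zero (h : M ∈ uC 0) : M = !![M 0 0, M 0 1, 0; M 1 0, -M 0 0, 0; 0, 0, 0] := by
  have htau : tau M = M := by simpa [uC] using h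
  have hentry : ∀ i j, tau M i j = M i j := fun i j => by rw [htau]
  simp only [tau_eq, Fin.forall_fin_succ] at hentry
  ext i j
  fin_cases i <;> fin_cases j <;> simp at hentry ⊢ <;> grind

theorem eq_of_mem_uC_two (h : M ∈ uC 2) : M = Matrix.diagonal ![M 0 0, M 0 0, M 2 2] := by
  have htau : tau M = -M := by simpa [uC, zpow_ofNat] using h
  have hentry : ∀ i j, tau M i j = -M i j := fun i j => by rw [htau]; rfl
  simp only [tau_eq, Fin.forall_fin_succ] at hentry
  ext i j
  fin_cases i <;> fin_cases j <;> simp at hentry ⊢ <;> grind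

theorem apply_two_two_of_mem_uC_of_odd (h : M ∈ uC a) (ha : Odd a) : M 2 2 = 0 := by
  have hsq : Complex.I ^ a ≠ -1 := fun hI => by
    have h2a : (4 : ℤ) ∣ 2 * a := (Complex.isPrimitiveRoot_I.zpow_eq_one_iff_dvd _).1 (by
      rw [mul_comm, zpow_mul, hI]; norm_num)
    obtain ⟨k, rfl⟩ := ha
    omega
  have hentry : tau M 2 2 = Complex.I ^ a * M 2 2 := congrFun (congrFun h 2) 2
  have hmul : (Complex.I ^ a + 1) * M 2 2 = 0 := by
    simp [tau_eq] at hentry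
    linear_combination -hentry
  exact (mul_eq_zero.1 hmul).resolve_left fun h0 => hsq (eq_neg_of_add_eq_zero_left h0)

theorem lie_eq_zero_of_mem_uC_zero_two (hM : M ∈ uC 0) (hN : N ∈ uC 2) : ⁅M, N⁆ = 0 := by
  rw [eq_of_mem_uC_zero hM, eq_of_mem_uC_two hN, Ring.lie_def]
  ext i j
  rw [Matrix.sub_apply, Matrix.mul_diagonal, Matrix.diagonal_mul]
  fin_cases i <;> fin_cases j <;> simp [mul_comm]

theorem lie_eq_zero_of_mem_uC_two (hM : M ∈ uC 2) (hN : N ∈ uC 2) : ⁅M, N⁆ = 0 := by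
  rw [eq_of_mem_uC_two hM, eq_of_mem_uC_two hN, Ring.lie_def, Matrix.diagonal_mul_diagonal,
    Matrix.diagonal_mul_diagonal]
  simp only [mul_comm, sub_self]

end Eigenspaces

section Gauge

variable {g M : M3}

/-- The element of `U(3)_0` with second column `(p, q, 0)`. -/
def suMat (p q : ℂ) : M3 := !![star q, p, 0; -star p, q, 0; 0, 0, 1]

theorem conjTranspose_suMat (p q : ℂ) : (suMat p q)ᴴ = suMat (-p) (star q) := by
  ext i j
  fin_cases i <;> fin_cases j <;> simp [suMat]

theorem tau_conjTranspose_suMat (p q : ℂ) : tau (suMat p q)ᴴ = -suMat p q := by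
  ext i j
  fin_cases i <;> fin_cases j <;> simp [suMat, tau_eq]

theorem suMat_mem {p q : ℂ} (h : star p * p + star q * q = 1) : suMat p q ∈ U30 := by
  have hunit : (suMat p q)ᴴ * suMat p q = 1 := by
    ext i j
    fin_cases i <;> fin_cases j <;>
      simp [suMat, Matrix.mul_apply, Fin.sum_univ_three] at h ⊢ <;> grind
  refine ⟨Matrix.mem_unitaryGroup_iff'.2 hunit, ?_, by simp [suMat]⟩
  rw [← neg_inj, ← tau_inv, Matrix.inv_eq_left_inv hunit, tau_conjTranspose_suMat]

theorem inv_eq_conjTranspose_of_mem_unitaryGroup (hg : g ∈ Matrix.unitaryGroup (Fin 3) ℂ) :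
    g⁻¹ = gᴴ :=
  Matrix.inv_eq_left_inv (Matrix.mem_unitaryGroup_iff'.1 hg)

theorem mem_U30_iff : g ∈ U30 ↔ ∃ p q : ℂ, star p * p + star q * q = 1 ∧ g = suMat p q := by
  refine ⟨fun ⟨hu, ht, h22⟩ => ⟨g 0 1, g 1 1, ?_⟩, by rintro ⟨p, q, h, rfl⟩; exact suMat_mem h⟩
  have hfix : tau gᴴ = -g := by
    rw [← inv_eq_conjTranspose_of_mem_unitaryGroup hu, tau_inv, ht]
  have hentry : ∀ i j, tau gᴴ i j = -g i j := fun i j => by rw [hfix]; rfl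
  have h00 : star (g 1 1) = g 0 0 := by simpa [tau_eq] using hentry 0 0
  have h10 : -star (g 0 1) = g 1 0 := by simpa [tau_eq, neg_eq_iff_eq_neg] using hentry 1 0
  have h02 : star (g 1 2) = g 0 2 := by simpa [tau_eq] using hentry 0 2
  have h12 : star (g 0 2) = -g 1 2 := by simpa [tau_eq] using hentry 1 2
  have h20 : star (g 2 1) = g 2 0 := by simpa [tau_eq] using hentry 2 0
  have h21 : star (g 2 0) = -g 2 1 := by simpa [tau_eq] using hentry 2 1
  have hzero : ∀ {x y : ℂ}, star x = y → star y = -x → x = 0 ∧ y = 0 := by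
    rintro x _ rfl hx
    have hx0 : x = 0 := self_eq_neg.1 ((star_star x).symm.trans hx)
    simp [hx0]
  obtain ⟨hg12, hg02⟩ := hzero h02 h12
  obtain ⟨hg21, hg20⟩ := hzero h20 h21
  have hcol : (star g * g) 1 1 = (1 : M3) 1 1 := by rw [Matrix.mem_unitaryGroup_iff'.1 hu]
  refine ⟨by simpa [Matrix.mul_apply, Fin.sum_univ_three, hg21] using hcol, ?_⟩
  ext i j
  fin_cases i <;> fin_cases j <;> simp [suMat, hg12, hg02, hg21, hg20, h22, ← h00, ← h10]

variable (hg : g ∈ U30)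
include hg

theorem det_of_mem_U30 : g.det = 1 := by
  obtain ⟨p, q, h, rfl⟩ := mem_U30_iff.1 hg
  simpa [suMat, Matrix.det_fin_three, mul_comm, add_comm] using h

theorem isUnit_det_of_mem_U30 : IsUnit g.det := by rw [det_of_mem_U30 hg]; exact isUnit_one

theorem apply_two_of_mem_U30 (i : Fin 3) : g i 2 = (1 : M3) i 2 := by
  obtain ⟨p, q, -, rfl⟩ := mem_U30_iff.1 hg
  fin_cases i <;> simp [suMat, Matrix.one_apply]

theorem inv_mem_U30 : g⁻¹ ∈ U30 := by
  rw [inv_eq_conjTranspose_of_mem_unitaryGroup hg.1]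
  obtain ⟨p, q, h, rfl⟩ := mem_U30_iff.1 hg
  rw [conjTranspose_suMat]
  exact suMat_mem (by simpa [mul_comm] using h)

theorem tau_inv_of_mem_U30 : tau g⁻¹ = -g := by rw [tau_inv, hg.2.1]

theorem tau_of_mem_U30 : tau g = -g⁻¹ := by
  rw [← tau_inv_of_mem_U30 (inv_mem_U30 hg), Matrix.nonsing_inv_nonsing_inv _
    (isUnit_det_of_mem_U30 hg)]

theorem tau_conj (M : M3) : tau (g⁻¹ * M * g) = g⁻¹ * tau M * g := by
  rw [tau_mul, tau_mul, tau_inv_of_mem_U30 hg, tau_of_mem_U30 hg]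
  simp only [mul_neg, neg_mul, neg_neg, mul_assoc]

theorem tauComp_conj (a : ℤ) (M : M3) : tauComp a (g⁻¹ * M * g) = g⁻¹ * tauComp a M * g := by
  simp only [tauComp_eq, tau_conj hg, mul_add, add_mul, mul_smul_comm, smul_mul_assoc]

theorem conj_mem_uC {a : ℤ} (hM : M ∈ uC a) : g⁻¹ * M * g ∈ uC a := by
  rw [mem_uC_iff] at *
  rw [tau_conj hg, hM, mul_smul_comm, smul_mul_assoc]

end Gauge

section Projection

/-- The projection onto `u(3)_0` as a real linear map. -/
def suPartLin : M3 →ₗ[ℝ] M3 where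
  toFun := suPart
  map_add' M N := by
    ext i j
    fin_cases i <;> fin_cases j <;> simp [suPart] <;> ring
  map_smul' c M := by
    ext i j
    fin_cases i <;> fin_cases j <;> simp [suPart] <;> ring

theorem suPart_sub_of_mem_borel {M B : M3} (hM : M ∈ uC 0) (hskew : Mᴴ = -M) (hB : B ∈ borel) :
    suPart (M - B) = M := by
  obtain ⟨t, c, rfl⟩ := hB
  have hre : (M 0 0).re = 0 := by
    have h00 := congrArg Complex.re (congrFun (congrFun hskew 0) 0)
    simp at h00
    linarith
  have h00 : M 0 0 = (M 0 0).im * Complex.I := by apply Complex.ext <;> simp [hre]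
  have h10 : star (M 0 1) = -M 1 0 := congrFun (congrFun hskew 1) 0
  rw [eq_of_mem_uC_zero hM]
  ext i j
  fin_cases i <;> fin_cases j <;> simp [suPart] at h10 ⊢ <;> grind

end Projection

section Characters

theorem injective_zpow_circle : Function.Injective fun (k : ℤ) (l : Circle) => (l : ℂ) ^ k := by
  intro a b hab
  obtain ⟨n, hn⟩ : ∃ n, n = (a - b).natAbs + 1 := ⟨_, rfl⟩
  have hζ := Complex.isPrimitiveRoot_exp n (by omega)
  set ζ := Complex.exp (2 * Real.pi * Complex.I / n)
  let l : Circle := ⟨ζ, mem_sphere_zero_iff_norm.2 (hζ.norm'_eq_one (by omega))⟩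
  have hl : ζ ^ a = ζ ^ b := congrFun hab l
  have hdvd : (n : ℤ) ∣ a - b := (hζ.zpow_eq_one_iff_dvd _).1 (by
    have hζ0 : ζ ≠ 0 := Complex.exp_ne_zero _
    rw [zpow_sub₀ hζ0, hl, div_self (zpow_ne_zero _ hζ0)])
  exact sub_eq_zero.1 (Int.eq_zero_of_abs_lt_dvd hdvd (by rw [Int.abs_eq_natAbs]; omega))

theorem linearIndependent_zpow_circle :
    LinearIndependent ℂ fun (k : ℤ) (l : Circle) => (l : ℂ) ^ k :=
  let χ : ℤ → Circle →* ℂ := fun k => (zpowGroupHom k).comp ((Circle.coeHom : Circle →* ℂ))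
  (linearIndependent_monoidHom Circle ℂ).comp χ fun _ _ h =>
    injective_zpow_circle (funext fun l => DFunLike.congr_fun h l)

theorem sum_zpow_smul_eq_iff {V : Type*} [AddCommGroup V] [Module ℂ V] {s : Finset ℤ}
    {c c' : ℤ → V} (hc : ∀ k ∉ s, c k = 0) (hc' : ∀ k ∉ s, c' k = 0) :
    (∀ l : Circle, ∑ k ∈ s, (l : ℂ) ^ k • c k = ∑ k ∈ s, (l : ℂ) ^ k • c' k) ↔
      ∀ k, c k = c' k := by
  refine ⟨fun h k => ?_, fun h l => by simp only [h]⟩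
  by_cases hk : k ∈ s
  · refine sub_eq_zero.1 ((Module.forall_dual_apply_eq_zero_iff ℂ _).1 fun φ => ?_)
    refine linearIndependent_iff'.1 linearIndependent_zpow_circle s (fun k => φ (c k - c' k))
      (funext fun l => ?_) k hk
    have hl := congrArg φ (sub_eq_zero.2 (h l))
    simpa [← Finset.sum_sub_distrib, ← smul_sub, mul_comm] using hl
  · rw [hc k hk, hc' k hk]

end Characters

namespace Loop

/-- The value of a loop at a point of the circle as a ring homomorphism. -/
def evalRingHom (l : Circle) : Loop →+* M3 :=
  AddMonoidAlgebra.liftNCRingHom (RingHom.id M3)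
    { toFun := fun k => algebraMap ℂ M3 ((l : ℂ) ^ (Multiplicative.toAdd k))
      map_one' := by simp
      map_mul' := fun a b => by
        rw [toAdd_mul, zpow_add₀ (Circle.coe_ne_zero l), map_mul] }
    fun x y => (Algebra.commutes (R := ℂ) ((l : ℂ) ^ (Multiplicative.toAdd y)) x).symm

theorem evalRingHom_apply (l : Circle) (ξ : Loop) : evalRingHom l ξ = ξ.evalAt l := by
  change ξ.coeff.sum _ = ξ.coeff.sum _
  refine Finsupp.sum_congr fun k _ => ?_
  change ξ.coeff k * algebraMap ℂ M3 ((l : ℂ) ^ k) = _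
  rw [← Algebra.commutes, Algebra.smul_def]

variable {ξ ζ : Loop} (l : Circle)

theorem evalAt_add : (ξ + ζ).evalAt l = ξ.evalAt l + ζ.evalAt l := by
  simp only [← evalRingHom_apply, map_add]

theorem evalAt_sub : (ξ - ζ).evalAt l = ξ.evalAt l - ζ.evalAt l := by
  simp only [← evalRingHom_apply, map_sub]

theorem evalAt_mul : (ξ * ζ).evalAt l = ξ.evalAt l * ζ.evalAt l := by
  simp only [← evalRingHom_apply, map_mul]

theorem evalAt_lie : evalAt ⁅ξ, ζ⁆ l = ⁅ξ.evalAt l, ζ.evalAt l⁆ := by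
  simp only [Ring.lie_def, evalAt_sub, evalAt_mul]

theorem evalAt_single (k : ℤ) (M : M3) :
    evalAt (AddMonoidAlgebra.single k M) l = (l : ℂ) ^ k • M :=
  Finsupp.sum_single_index (h := fun k m => (l : ℂ) ^ k • m) (smul_zero _)

theorem evalAt_C (M : M3) : evalAt (LaurentPolynomial.C M) l = M := by
  rw [← LaurentPolynomial.single_eq_C, evalAt_single, zpow_zero, one_smul]

theorem evalAt_eq_sum {s : Finset ℤ} (hs : ∀ k ∉ s, ξ.coeff k = 0) :
    ξ.evalAt l = ∑ k ∈ s, (l : ℂ) ^ k • ξ.coeff k :=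
  Finsupp.sum_of_support_subset _ (fun k hk => not_imp_comm.1 (hs k) (Finsupp.mem_support_iff.1 hk))
    _ (by simp)

theorem ext_evalAt (h : ∀ l, ξ.evalAt l = ζ.evalAt l) : ξ = ζ := by
  have hξ : ∀ k ∉ ξ.coeff.support ∪ ζ.coeff.support, ξ.coeff k = 0 := fun k hk => by
    simp only [Finset.mem_union, Finsupp.mem_support_iff, not_or, not_not] at hk
    exact hk.1
  have hζ : ∀ k ∉ ξ.coeff.support ∪ ζ.coeff.support, ζ.coeff k = 0 := fun k hk => by
    simp only [Finset.mem_union, Finsupp.mem_support_iff, not_or, not_not] at hk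
    exact hk.2
  refine AddMonoidAlgebra.ext (Finsupp.ext <| (sum_zpow_smul_eq_iff hξ hζ).1 fun l => ?_)
  rw [← evalAt_eq_sum l hξ, ← evalAt_eq_sum l hζ, h]

theorem coeff_conj (a b : M3) (ξ : Loop) (k : ℤ) :
    (LaurentPolynomial.C a * ξ * LaurentPolynomial.C b).coeff k = a * ξ.coeff k * b := by
  rw [← LaurentPolynomial.single_eq_C, ← LaurentPolynomial.single_eq_C,
    AddMonoidAlgebra.coeff_mul_single_zero, AddMonoidAlgebra.coeff_single_zero_mul]

theorem evalAt_conj (a b : M3) (ξ : Loop) :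
    evalAt (LaurentPolynomial.C a * ξ * LaurentPolynomial.C b) l = a * ξ.evalAt l * b := by
  rw [evalAt_mul, evalAt_mul, evalAt_C, evalAt_C]

theorem coeff_lie_single (ξ : Loop) (m k : ℤ) (M : M3) :
    (⁅ξ, (AddMonoidAlgebra.single m M : Loop)⁆ : Loop).coeff k = ⁅ξ.coeff (k - m), M⁆ := by
  have hright := AddMonoidAlgebra.coeff_mul_single_add ξ M m (k - m)
  have hleft := AddMonoidAlgebra.coeff_single_mul_add ξ M m (k - m)
  rw [sub_add_cancel] at hright
  rw [add_sub_cancel] at hleft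
  rw [Ring.lie_def, Ring.lie_def, AddMonoidAlgebra.coeff_sub, Finsupp.sub_apply, hright, hleft]

end Loop

section LoopSpaces

variable {n : ℕ} {ξ : Loop}

theorem notMem_Icc_neg_iff {n k : ℤ} : k ∉ Finset.Icc (-n) n ↔ n < |k| := by
  rw [Finset.mem_Icc, ← abs_le, not_le]

theorem coeff_eq_zero_of_notMem_Icc (h : ∀ k : ℤ, (n : ℤ) < |k| → ξ.coeff k = 0) {k : ℤ}
    (hk : k ∉ Finset.Icc (-(n : ℤ)) n) : ξ.coeff k = 0 :=
  h k (notMem_Icc_neg_iff.1 hk)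

theorem star_circle_zpow (l : Circle) (k : ℤ) : star ((l : ℂ) ^ k) = (l : ℂ) ^ (-k) := by
  rw [star_zpow₀, zpow_neg, ← inv_zpow, ← Circle.coe_inv, Circle.coe_inv_eq_conj]
  rfl

theorem mem_LoopU_iff : ξ ∈ LoopU n ↔
    (∀ k : ℤ, (n : ℤ) < |k| → ξ.coeff k = 0) ∧ ∀ k, (ξ.coeff (-k))ᴴ = -ξ.coeff k := by
  refine and_congr_right fun hn => ?_
  have hs : ∀ k ∉ Finset.Icc (-(n : ℤ)) n, ξ.coeff k = 0 := fun _ =>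
    coeff_eq_zero_of_notMem_Icc hn
  have hstar : ∀ l : Circle, (ξ.evalAt l)ᴴ = ∑ k ∈ Finset.Icc (-(n : ℤ)) n,
      (l : ℂ) ^ k • (ξ.coeff (-k))ᴴ := fun l => by
    rw [Loop.evalAt_eq_sum l hs, Matrix.conjTranspose_sum]
    refine Finset.sum_equiv (Equiv.neg ℤ) (fun k => ?_) fun k _ => ?_
    · rw [not_iff_not.symm, notMem_Icc_neg_iff, notMem_Icc_neg_iff, Equiv.neg_apply, abs_neg]
    · rw [Matrix.conjTranspose_smul, Equiv.neg_apply, neg_neg, star_circle_zpow]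
  have hneg : ∀ l : Circle, -ξ.evalAt l = ∑ k ∈ Finset.Icc (-(n : ℤ)) n,
      (l : ℂ) ^ k • -ξ.coeff k := fun l => by
    simp only [Loop.evalAt_eq_sum l hs, smul_neg, Finset.sum_neg_distrib]
  simp only [hstar, hneg]
  refine sum_zpow_smul_eq_iff (fun k hk => ?_) fun k hk => by rw [hs k hk, neg_zero]
  rw [hs (-k), Matrix.conjTranspose_zero]
  rwa [notMem_Icc_neg_iff, abs_neg, ← notMem_Icc_neg_iff]

theorem mem_LoopUTau_iff : ξ ∈ LoopUTau n ↔ ξ ∈ LoopU n ∧ ∀ k, ξ.coeff k ∈ uC k := by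
  refine and_congr_right fun hn => ?_
  have hs : ∀ k ∉ Finset.Icc (-(n : ℤ)) n, ξ.coeff k = 0 := fun _ =>
    coeff_eq_zero_of_notMem_Icc hn.1
  have htau : ∀ l : Circle, tau (ξ.evalAt l) = ∑ k ∈ Finset.Icc (-(n : ℤ)) n,
      (l : ℂ) ^ k • tau (ξ.coeff k) := fun l => by
    rw [Loop.evalAt_eq_sum l hs]
    exact (map_sum tauLin _ _).trans (Finset.sum_congr rfl fun k _ => tau_smul _ _)
  have hrot : ∀ l : Circle, ξ.evalAt (circleI * l) = ∑ k ∈ Finset.Icc (-(n : ℤ)) n,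
      (l : ℂ) ^ k • (Complex.I ^ k • ξ.coeff k) := fun l => by
    rw [Loop.evalAt_eq_sum _ hs]
    refine Finset.sum_congr rfl fun k _ => ?_
    rw [Circle.coe_mul, mul_zpow, smul_smul, mul_comm]
    rfl
  simp only [htau, hrot]
  refine sum_zpow_smul_eq_iff (fun k hk => ?_) fun k hk => by rw [hs k hk, smul_zero]
  rw [hs k hk]
  exact tauLin.map_zero

theorem conj_mem_LoopU (h : ξ ∈ LoopU n) {g : M3} (hg : g ∈ Matrix.unitaryGroup (Fin 3) ℂ) :
    LaurentPolynomial.C g⁻¹ * ξ * LaurentPolynomial.C g ∈ LoopU n := by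
  refine ⟨fun k hk => by rw [Loop.coeff_conj, h.1 k hk, mul_zero, zero_mul], fun l => ?_⟩
  rw [inv_eq_conjTranspose_of_mem_unitaryGroup hg, Loop.evalAt_conj]
  simp only [Matrix.conjTranspose_mul, h.2, Matrix.conjTranspose_conjTranspose, mul_neg, neg_mul,
    mul_assoc]

end LoopSpaces

section ShortLoop

/-- The loop `λ⁻² a + λ⁻¹ b + c - λ b† - λ² a†`, of the form of the deformed Maurer--Cartan
forms. -/
def shortLoop (a b c : M3) : Loop :=
  AddMonoidAlgebra.single (-2) a + AddMonoidAlgebra.single (-1) b + AddMonoidAlgebra.single 0 c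
    - AddMonoidAlgebra.single 1 bᴴ - AddMonoidAlgebra.single 2 aᴴ

theorem evalAt_shortLoop (a b c : M3) (l : Circle) : (shortLoop a b c).evalAt l =
    (l : ℂ) ^ (-2 : ℤ) • a + (l : ℂ) ^ (-1 : ℤ) • b + c - (l : ℂ) • bᴴ - (l : ℂ) ^ 2 • aᴴ := by
  simp only [shortLoop, Loop.evalAt_add, Loop.evalAt_sub, Loop.evalAt_single, zpow_zero, one_smul,
    zpow_one]
  norm_cast

theorem shortLoop_inj {a b c a' b' c' : M3} (h : shortLoop a b c = shortLoop a' b' c') :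
    a = a' ∧ b = b' ∧ c = c' := by
  have hcoeff : ∀ k : ℤ, (shortLoop a b c).coeff k = (shortLoop a' b' c').coeff k := by simp [h]
  simp only [shortLoop, AddMonoidAlgebra.coeff_add, AddMonoidAlgebra.coeff_sub, Finsupp.add_apply,
    Finsupp.sub_apply, AddMonoidAlgebra.coeff_single, Finsupp.single_apply] at hcoeff
  exact ⟨by simpa using hcoeff (-2), by simpa using hcoeff (-1), by simpa using hcoeff 0⟩

theorem shortLoop_conj {g : M3} (hg : g ∈ Matrix.unitaryGroup (Fin 3) ℂ) (a b c : M3) :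
    LaurentPolynomial.C g⁻¹ * shortLoop a b c * LaurentPolynomial.C g
      = shortLoop (g⁻¹ * a * g) (g⁻¹ * b * g) (g⁻¹ * c * g) := by
  refine Loop.ext_evalAt fun l => ?_
  rw [inv_eq_conjTranspose_of_mem_unitaryGroup hg, Loop.evalAt_conj]
  simp only [evalAt_shortLoop, Matrix.conjTranspose_mul,
    Matrix.conjTranspose_conjTranspose, mul_add, add_mul, mul_sub, sub_mul, mul_smul_comm,
    smul_mul_assoc, mul_assoc]

theorem coeff_lie_shortLoop (ξ : Loop) (a b c : M3) (k : ℤ) :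
    (⁅ξ, shortLoop a b c⁆ : Loop).coeff k = ⁅ξ.coeff (k + 2), a⁆ + ⁅ξ.coeff (k + 1), b⁆
      + ⁅ξ.coeff k, c⁆ - ⁅ξ.coeff (k - 1), bᴴ⁆ - ⁅ξ.coeff (k - 2), aᴴ⁆ := by
  have hlie_sub : ∀ x y z : Loop, ⁅x, y - z⁆ = ⁅x, y⁆ - ⁅x, z⁆ := fun x y z => by
    rw [Ring.lie_def, Ring.lie_def, Ring.lie_def, mul_sub, sub_mul]
    abel
  simp only [shortLoop, hlie_sub, ring_lie_add, AddMonoidAlgebra.coeff_add,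
    AddMonoidAlgebra.coeff_sub, Finsupp.add_apply, Finsupp.sub_apply, Loop.coeff_lie_single,
    sub_neg_eq_add, sub_zero]

theorem coeff_shifted (p : ℕ) (ξ : Loop) (v : ℂ) (k : ℤ) :
    (shifted p ξ v).coeff k = v • ξ.coeff (k - 4 * p) := by
  rw [shifted, LaurentPolynomial.T_mul, AddMonoidAlgebra.coeff_smul_apply]
  have hshift := AddMonoidAlgebra.coeff_mul_single_add ξ (1 : M3) (4 * (p : ℤ)) (k - 4 * p)
  rw [sub_add_cancel, mul_one] at hshift
  rw [← hshift]
  rfl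

theorem sum_support_neg_eq {X : Loop} (hX : ∀ k < -2, X.coeff k = 0) {A : Type*} [AddCommMonoid A]
    {f : ℤ → A} (hf : ∀ k, X.coeff k = 0 → f k = 0) :
    ∑ k ∈ X.coeff.support with k < 0, f k = f (-2) + f (-1) := by
  rw [← Finset.sum_pair (show (-2 : ℤ) ≠ -1 by norm_num)]
  refine Finset.sum_subset (fun k hk => ?_) fun k hk hk' => hf k (by_contra fun hne => hk' ?_)
  · obtain ⟨hsupp, hneg⟩ := Finset.mem_filter.1 hk
    have hlow : ¬k < -2 := fun hlt => Finsupp.mem_support_iff.1 hsupp (hX k hlt)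
    simp only [Finset.mem_insert, Finset.mem_singleton]
    omega
  · refine Finset.mem_filter.2 ⟨Finsupp.mem_support_iff.2 hne, ?_⟩
    simp only [Finset.mem_insert, Finset.mem_singleton] at hk
    omega

variable {p : ℕ} {ξ : Loop} (hξ : ξ ∈ LoopU (2 + 4 * p))
include hξ

theorem coeff_shifted_eq_zero (v : ℂ) : ∀ k < -2, (shifted p ξ v).coeff k = 0 := fun k hk => by
  rw [coeff_shifted, hξ.1, smul_zero]
  rw [lt_abs]
  push_cast
  omega

theorem projSu_shifted (v : ℂ) : (shifted p ξ v).projSu =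
    shortLoop (v • ξ.coeff (-4 * (p : ℤ) - 2)) (v • ξ.coeff (-4 * (p : ℤ) - 1))
      (suPart (v • ξ.coeff (-4 * (p : ℤ)))) := by
  rw [Loop.projSu, sum_support_neg_eq (coeff_shifted_eq_zero hξ v) (fun k hk => by simp [hk]),
    shortLoop, LaurentPolynomial.single_eq_C]
  simp only [coeff_shifted, neg_neg]
  rw [show (-2 : ℤ) - 4 * p = -4 * (p : ℤ) - 2 by ring,
    show (-1 : ℤ) - 4 * p = -4 * (p : ℤ) - 1 by ring, show (0 : ℤ) - 4 * p = -4 * (p : ℤ) by ring]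
  abel

theorem evalAt_projBased_shifted (v : ℂ) (l : Circle) : (shifted p ξ v).projBased.evalAt l =
    (shortLoop (v • ξ.coeff (-4 * (p : ℤ) - 2)) (v • ξ.coeff (-4 * (p : ℤ) - 1)) 0).evalAt l
      - (shortLoop (v • ξ.coeff (-4 * (p : ℤ) - 2)) (v • ξ.coeff (-4 * (p : ℤ) - 1)) 0).evalAt 1
    := by
  rw [Loop.projBased, sum_support_neg_eq (coeff_shifted_eq_zero hξ v) (fun k hk => by simp [hk])]
  simp only [coeff_shifted, evalAt_shortLoop, Loop.evalAt_add, Loop.evalAt_sub, Loop.evalAt_C,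
    Loop.evalAt_single, neg_neg, Circle.coe_one, one_zpow, one_pow, one_smul, zpow_ofNat,
    pow_one]
  rw [show (-2 : ℤ) - 4 * p = -4 * (p : ℤ) - 2 by ring,
    show (-1 : ℤ) - 4 * p = -4 * (p : ℤ) - 1 by ring]
  abel

end ShortLoop

section Calculus

variable {E V W : Type*} [NormedAddCommGroup E] [NormedSpace ℝ E] [NormedAddCommGroup V]
  [NormedSpace ℝ V] [NormedAddCommGroup W] [NormedSpace ℝ W] {Ω : Set E} {z : E}

theorem fderiv_linearMap_comp_apply [FiniteDimensional ℝ V] (L : V →ₗ[ℝ] W) {f : E → V}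
    (hf : DifferentiableAt ℝ f z) (v : E) :
    fderiv ℝ (fun w => L (f w)) z v = L (fderiv ℝ f z v) := by
  have hL := L.toContinuousLinearMap.hasFDerivAt.comp z hf.hasFDerivAt
  exact DFunLike.congr_fun hL.fderiv v

theorem contDiffOn_linearMap_comp [FiniteDimensional ℝ V] (L : V →ₗ[ℝ] W) {f : E → V}
    (hf : ContDiffOn ℝ ∞ f Ω) : ContDiffOn ℝ ∞ (fun w => L (f w)) Ω :=
  L.toContinuousLinearMap.contDiff.comp_contDiffOn hf

theorem differentiableAt_of_contDiffOn {f : E → V} (hΩ : IsOpen Ω) (hf : ContDiffOn ℝ ∞ f Ω)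
    (hz : z ∈ Ω) : DifferentiableAt ℝ f z :=
  (hf.contDiffAt (hΩ.mem_nhds hz)).differentiableAt (by simp)

theorem contDiffOn_fderiv_apply {f : E → V} (hΩ : IsOpen Ω) (hf : ContDiffOn ℝ ∞ f Ω) (v : E) :
    ContDiffOn ℝ ∞ (fun w => fderiv ℝ f w v) Ω :=
  ((contDiffOn_infty_iff_fderiv_of_isOpen hΩ).1 hf).2.clm_apply contDiffOn_const

theorem fderiv_fderiv_apply_comm {f : E → V} (hΩ : IsOpen Ω) (hf : ContDiffOn ℝ ∞ f Ω)
    (hz : z ∈ Ω) (u v : E) :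
    fderiv ℝ (fun w => fderiv ℝ f w v) z u = fderiv ℝ (fun w => fderiv ℝ f w u) z v := by
  have hf' : DifferentiableAt ℝ (fderiv ℝ f) z := differentiableAt_of_contDiffOn hΩ
    ((contDiffOn_infty_iff_fderiv_of_isOpen hΩ).1 hf).2 hz
  have hderiv : ∀ u v, fderiv ℝ (fun w => fderiv ℝ f w v) z u = fderiv ℝ (fderiv ℝ f) z u v :=
    fun u v => by
      rw [fderiv_clm_apply hf' (differentiableAt_const v)]
      simp
  rw [hderiv, hderiv]
  exact ((hf.contDiffAt (hΩ.mem_nhds hz)).isSymmSndFDerivAt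
    (by simpa using (by norm_cast : (2 : WithTop ℕ∞) ≤ ∞))) u v

variable {n : Type*} [Fintype n] {f g : E → Matrix n n ℂ}

theorem fderiv_matrix_mul_apply (hf : DifferentiableAt ℝ f z) (hg : DifferentiableAt ℝ g z)
    (v : E) : fderiv ℝ (fun w => f w * g w) z v = f z * fderiv ℝ g z v + fderiv ℝ f z v * g z := by
  classical
  exact DFunLike.congr_fun (fderiv_fun_mul' hf hg) v

theorem contDiffOn_entry (hf : ContDiffOn ℝ ∞ f Ω) (i j : n) :
    ContDiffOn ℝ ∞ (fun w => f w i j) Ω :=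
  contDiffOn_linearMap_comp (Matrix.entryLinearMap ℝ ℂ i j) hf

omit [Fintype n] in
theorem fderiv_entry_apply [Finite n] (hf : DifferentiableAt ℝ f z) (i j : n) (v : E) :
    fderiv ℝ (fun w => f w i j) z v = fderiv ℝ f z v i j :=
  have := Fintype.ofFinite n
  fderiv_linearMap_comp_apply (Matrix.entryLinearMap ℝ ℂ i j) hf v

variable [DecidableEq n]

theorem contDiffOn_matrix_inv (hf : ContDiffOn ℝ ∞ f Ω) (hu : ∀ z ∈ Ω, IsUnit (f z)) :
    ContDiffOn ℝ ∞ (fun w => (f w)⁻¹) Ω := fun z hz => by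
  simp only [Matrix.nonsing_inv_eq_ringInverse]
  obtain ⟨u, hu⟩ := hu z hz
  exact ContDiffAt.comp_contDiffWithinAt z (hu ▸ contDiffAt_ringInverse ℝ u) (hf z hz)

theorem hasFDerivAt_matrix_inv (hf : DifferentiableAt ℝ f z) (hu : IsUnit (f z)) :
    HasFDerivAt (fun w => (f w)⁻¹)
      ((-ContinuousLinearMap.mulLeftRight ℝ (Matrix n n ℂ) (f z)⁻¹ (f z)⁻¹ :
        Matrix n n ℂ →L[ℝ] Matrix n n ℂ) ∘L fderiv ℝ f z) z := by
  obtain ⟨u, hu⟩ := hu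
  simp only [Matrix.nonsing_inv_eq_ringInverse, ← hu, Ring.inverse_unit]
  exact HasFDerivAt.comp z (hu ▸ hasFDerivAt_ringInverse (𝕜 := ℝ) u) hf.hasFDerivAt

theorem fderiv_matrix_inv_apply (hf : DifferentiableAt ℝ f z) (hu : IsUnit (f z)) (v : E) :
    fderiv ℝ (fun w => (f w)⁻¹) z v = -((f z)⁻¹ * fderiv ℝ f z v * (f z)⁻¹) :=
  DFunLike.congr_fun (hasFDerivAt_matrix_inv hf hu).fderiv v

theorem fderiv_conj_apply (hf : DifferentiableAt ℝ f z) (hg : DifferentiableAt ℝ g z)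
    (hu : IsUnit (g z)) (v : E) : fderiv ℝ (fun w => (g w)⁻¹ * f w * g w) z v =
      (g z)⁻¹ * fderiv ℝ f z v * g z + ⁅(g z)⁻¹ * f z * g z, (g z)⁻¹ * fderiv ℝ g z v⁆ := by
  have hinv := (hasFDerivAt_matrix_inv hg hu).differentiableAt
  have hprod : DifferentiableAt ℝ (fun w => (g w)⁻¹ * f w) z := hinv.mul hf
  rw [fderiv_matrix_mul_apply hprod hg, fderiv_matrix_mul_apply hinv hf,
    fderiv_matrix_inv_apply hg hu, Ring.lie_def]
  have hcancel : (g z)⁻¹ * f z * g z * ((g z)⁻¹ * fderiv ℝ g z v)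
      = (g z)⁻¹ * f z * fderiv ℝ g z v := by
    rw [mul_assoc _ (g z),
      Matrix.mul_nonsing_inv_cancel_left _ _ ((Matrix.isUnit_iff_isUnit_det _).1 hu)]
  rw [hcancel]
  simp only [add_mul, neg_mul, mul_assoc]
  abel

end Calculus

section UnitaryGauge

/-- Smooth maps `Ω → U(3)`, the largest group of gauge transformations that occurs: it contains
`C^∞(Ω, U(3)_0)` and the framings themselves. -/
structure IsUnitaryGauge (Ω : Set ℂ) (g : ℂ → M3) : Prop where
  smooth : ContDiffOn ℝ ∞ g Ω
  unitary : ∀ z ∈ Ω, g z ∈ Matrix.unitaryGroup (Fin 3) ℂ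

variable {Ω : Set ℂ} {g : ℂ → M3} {z : ℂ}

theorem isUnit_of_mem_unitaryGroup {g : M3} (hg : g ∈ Matrix.unitaryGroup (Fin 3) ℂ) : IsUnit g :=
  (Unitary.toUnits ⟨g, hg⟩).isUnit

theorem IsGauge.isUnitaryGauge (hg : IsGauge Ω g) : IsUnitaryGauge Ω g :=
  ⟨hg.1, fun z hz => (hg.2 z hz).1⟩

theorem IsFamily.isUnitaryGauge {F : Circle → ℂ → M3} (hF : IsFamily Ω F) (l : Circle) :
    IsUnitaryGauge Ω (F l) :=
  ⟨hF.smooth l, hF.unitary l⟩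

theorem IsGauge.inv (hg : IsGauge Ω g) : IsGauge Ω fun z => (g z)⁻¹ :=
  ⟨contDiffOn_matrix_inv hg.1 fun z hz => isUnit_of_mem_unitaryGroup (hg.2 z hz).1,
    fun z hz => inv_mem_U30 (hg.2 z hz)⟩

namespace IsUnitaryGauge

theorem isUnit (hg : IsUnitaryGauge Ω g) (hz : z ∈ Ω) : IsUnit (g z) :=
  isUnit_of_mem_unitaryGroup (hg.unitary z hz)

theorem isUnit_det (hg : IsUnitaryGauge Ω g) (hz : z ∈ Ω) : IsUnit (g z).det :=
  (Matrix.isUnit_iff_isUnit_det _).1 (hg.isUnit hz)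

theorem differentiableAt (hg : IsUnitaryGauge Ω g) (hΩ : IsOpen Ω) (hz : z ∈ Ω) :
    DifferentiableAt ℝ g z :=
  differentiableAt_of_contDiffOn hΩ hg.smooth hz

theorem inv (hg : IsUnitaryGauge Ω g) : IsUnitaryGauge Ω fun z => (g z)⁻¹ :=
  ⟨contDiffOn_matrix_inv hg.smooth fun _ => hg.isUnit, fun z hz => by
    rw [inv_eq_conjTranspose_of_mem_unitaryGroup (hg.unitary z hz)]
    exact Unitary.star_mem (hg.unitary z hz)⟩

end IsUnitaryGauge

end UnitaryGauge

section MaurerCartan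

variable {Ω : Set ℂ} {f g : ℂ → M3} {z : ℂ}

theorem mc_congr (hΩ : IsOpen Ω) (h : Set.EqOn f g Ω) (hz : z ∈ Ω) (v : ℂ) :
    mc f z v = mc g z v := by
  rw [mc, mc, (h.eventuallyEq_of_mem (hΩ.mem_nhds hz)).fderiv_eq, h hz]

theorem mc_mul (hf : DifferentiableAt ℝ f z) (hg : DifferentiableAt ℝ g z) (hu : IsUnit (f z))
    (v : ℂ) : mc (fun w => f w * g w) z v = (g z)⁻¹ * mc f z v * g z + mc g z v := by
  rw [mc, mc, mc, fderiv_matrix_mul_apply hf hg, Matrix.mul_inv_rev, mul_add, add_comm]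
  congr 1
  · simp only [mul_assoc]
  · rw [mul_assoc, Matrix.nonsing_inv_mul_cancel_left _ _ ((Matrix.isUnit_iff_isUnit_det _).1 hu)]

variable (hΩ : IsOpen Ω) (hg : IsUnitaryGauge Ω g)
include hΩ hg

theorem contDiffOn_mc (v : ℂ) : ContDiffOn ℝ ∞ (fun w => mc g w v) Ω :=
  hg.inv.smooth.mul (contDiffOn_fderiv_apply hΩ hg.smooth v)

theorem mc_structure_equation (hz : z ∈ Ω) (u v : ℂ) :
    fderiv ℝ (fun w => mc g w v) z u - fderiv ℝ (fun w => mc g w u) z v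
      + ⁅mc g z u, mc g z v⁆ = 0 := by
  have hdg := hg.differentiableAt hΩ hz
  have hinv := hg.inv.differentiableAt hΩ hz
  have hd : ∀ v, DifferentiableAt ℝ (fun w => fderiv ℝ g w v) z := fun v =>
    differentiableAt_of_contDiffOn hΩ (contDiffOn_fderiv_apply hΩ hg.smooth v) hz
  have hsymm : fderiv ℝ (fun w => fderiv ℝ g w v) z u = fderiv ℝ (fun w => fderiv ℝ g w u) z v :=
    fderiv_fderiv_apply_comm hΩ hg.smooth hz u v
  have hderiv : ∀ u v, fderiv ℝ (fun w => mc g w v) z u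
      = (g z)⁻¹ * fderiv ℝ (fun w => fderiv ℝ g w v) z u - mc g z u * mc g z v := fun u v => by
    simp only [mc]
    rw [fderiv_matrix_mul_apply hinv (hd v), fderiv_matrix_inv_apply hdg (hg.isUnit hz)]
    simp only [mul_assoc, neg_mul, sub_eq_add_neg]
  rw [hderiv, hderiv, hsymm, Ring.lie_def]
  abel

theorem conjTranspose_mc (hz : z ∈ Ω) (v : ℂ) : (mc g z v)ᴴ = -mc g z v := by
  have hdg := hg.differentiableAt hΩ hz
  let starLin : M3 →ₗ[ℝ] M3 :=
    { toFun := Matrix.conjTranspose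
      map_add' := Matrix.conjTranspose_add
      map_smul' := fun r M => by simp }
  have hstar : (fun w => (g w)⁻¹) =ᶠ[nhds z] fun w => starLin (g w) := by
    filter_upwards [hΩ.mem_nhds hz] with w hw
    exact inv_eq_conjTranspose_of_mem_unitaryGroup (hg.unitary w hw)
  have hderiv : fderiv ℝ (fun w => (g w)⁻¹) z v = (fderiv ℝ g z v)ᴴ :=
    (DFunLike.congr_fun hstar.fderiv_eq v).trans (fderiv_linearMap_comp_apply starLin hdg v)
  rw [fderiv_matrix_inv_apply hdg (hg.isUnit hz)] at hderiv
  rw [mc, Matrix.conjTranspose_mul, ← hderiv,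
    inv_eq_conjTranspose_of_mem_unitaryGroup (hg.unitary z hz), Matrix.conjTranspose_conjTranspose,
    neg_mul, mul_assoc, ← Matrix.star_eq_conjTranspose,
    Matrix.mem_unitaryGroup_iff'.1 (hg.unitary z hz), mul_one]

omit hg in
theorem mc_mem_uC_zero (hg : IsGauge Ω g) (hz : z ∈ Ω) (v : ℂ) : mc g z v ∈ uC 0 := by
  have hdg := hg.isUnitaryGauge.differentiableAt hΩ hz
  have htau : (fun w => tau (g w)) =ᶠ[nhds z] fun w => -(g w)⁻¹ := by
    filter_upwards [hΩ.mem_nhds hz] with w hw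
    exact tau_of_mem_U30 (hg.2 w hw)
  have hderiv : tau (fderiv ℝ g z v) = (g z)⁻¹ * fderiv ℝ g z v * (g z)⁻¹ := by
    have hlin := fderiv_linearMap_comp_apply (tauLin.restrictScalars ℝ) hdg v
    have hneg : fderiv ℝ (fun w => -(g w)⁻¹) z v = -fderiv ℝ (fun w => (g w)⁻¹) z v :=
      DFunLike.congr_fun fderiv_fun_neg v
    refine hlin.symm.trans ((DFunLike.congr_fun htau.fderiv_eq v).trans ?_)
    rw [hneg, fderiv_matrix_inv_apply hdg (hg.isUnitaryGauge.isUnit hz), neg_neg]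
  rw [mem_uC_iff, zpow_zero, one_smul, mc, tau_mul, tau_inv_of_mem_U30 (hg.2 z hz), hderiv,
    mul_neg, neg_neg, Matrix.nonsing_inv_mul_cancel_right _ _ (hg.isUnitaryGauge.isUnit_det hz)]

end MaurerCartan

section LoopCalculus

variable {Ω : Set ℂ} {s : Finset ℤ} {ξ : ℂ → Loop} {z : ℂ} (hΩ : IsOpen Ω)
  (hsupp : ∀ z ∈ Ω, ∀ k ∉ s, (ξ z).coeff k = 0) (hsmooth : SmoothLoop Ω ξ) (hz : z ∈ Ω)
include hΩ hsupp hsmooth hz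

theorem hasFDerivAt_evalAt (l : Circle) : HasFDerivAt (fun w => (ξ w).evalAt l)
    (∑ k ∈ s, (l : ℂ) ^ k • fderiv ℝ (fun w => (ξ w).coeff k) z) z := by
  have hsum : HasFDerivAt (fun w => ∑ k ∈ s, (l : ℂ) ^ k • (ξ w).coeff k)
      (∑ k ∈ s, (l : ℂ) ^ k • fderiv ℝ (fun w => (ξ w).coeff k) z) z :=
    HasFDerivAt.fun_sum fun k _ =>
      (differentiableAt_of_contDiffOn hΩ (hsmooth k) hz).hasFDerivAt.const_smul ((l : ℂ) ^ k)
  refine hsum.congr_of_eventuallyEq ?_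
  filter_upwards [hΩ.mem_nhds hz] with w hw using Loop.evalAt_eq_sum l (hsupp w hw)

omit hsmooth in
theorem fderiv_coeff_apply_of_notMem {k : ℤ} (hk : k ∉ s) (v : ℂ) :
    fderiv ℝ (fun w => (ξ w).coeff k) z v = 0 := by
  have hzero : (fun w => (ξ w).coeff k) =ᶠ[nhds z] fun _ => 0 := by
    filter_upwards [hΩ.mem_nhds hz] with w hw using hsupp w hw k hk
  exact (DFunLike.congr_fun hzero.fderiv_eq v).trans (DFunLike.congr_fun (fderiv_const_apply _) v)

theorem fderiv_evalAt_eq_iff (v : ℂ) (B : Loop) :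
    (∀ l, fderiv ℝ (fun w => (ξ w).evalAt l) z v = B.evalAt l) ↔
      ∀ k, fderiv ℝ (fun w => (ξ w).coeff k) z v = B.coeff k := by
  let t := s ∪ B.coeff.support
  have hsupp' : ∀ z ∈ Ω, ∀ k ∉ t, (ξ z).coeff k = 0 := fun z hz k hk =>
    hsupp z hz k fun h => hk (Finset.mem_union_left _ h)
  have hB : ∀ k ∉ t, B.coeff k = 0 := fun k hk =>
    Finsupp.notMem_support_iff.1 fun h => hk (Finset.mem_union_right _ h)
  rw [← sum_zpow_smul_eq_iff
    (fun k hk => fderiv_coeff_apply_of_notMem hΩ hsupp' hz hk v) hB]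
  refine forall_congr' fun l => ?_
  rw [Loop.evalAt_eq_sum l hB, (hasFDerivAt_evalAt hΩ hsupp' hsmooth hz l).fderiv]
  simp

end LoopCalculus

section KillingFields

variable {Ω : Set ℂ} {n : ℕ} {ξ : ℂ → Loop} {A A' : Circle → ℂ → ℂ → M3} {G : ℂ → M3} {z : ℂ}

theorem coeff_gaugeLoop (k : ℤ) :
    (gaugeLoop ξ G z).coeff k = (G z)⁻¹ * (ξ z).coeff k * G z :=
  Loop.coeff_conj _ _ _ _

theorem evalAt_gaugeLoop (l : Circle) :
    (gaugeLoop ξ G z).evalAt l = (G z)⁻¹ * (ξ z).evalAt l * G z :=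
  Loop.evalAt_conj _ _ _ _

theorem SmoothLoop.gauge (hξ : SmoothLoop Ω ξ) (hG : IsUnitaryGauge Ω G) :
    SmoothLoop Ω (gaugeLoop ξ G) := fun k => by
  simp only [coeff_gaugeLoop]
  exact (hG.inv.smooth.mul (hξ k)).mul hG.smooth

theorem conj_lie {g : M3} (hg : IsUnit g) (X Y : M3) :
    g⁻¹ * ⁅X, Y⁆ * g = ⁅g⁻¹ * X * g, g⁻¹ * Y * g⁆ := by
  have hmul : ∀ X Y : M3, g⁻¹ * X * g * (g⁻¹ * Y * g) = g⁻¹ * (X * Y) * g := fun X Y => by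
    rw [mul_assoc (g⁻¹ * X), mul_assoc g⁻¹ Y,
      Matrix.mul_nonsing_inv_cancel_left _ _ ((Matrix.isUnit_iff_isUnit_det g).1 hg)]
    simp only [mul_assoc]
  rw [Ring.lie_def, Ring.lie_def, hmul, hmul, mul_sub, sub_mul]

theorem ring_lie_skew {R : Type*} [NonUnitalNonAssocRing R] (x y : R) : -⁅y, x⁆ = ⁅x, y⁆ := by
  rw [Ring.lie_def, Ring.lie_def, neg_sub]

theorem fderiv_evalAt_eq_lie_iff (hΩ : IsOpen Ω) (hmem : ∀ z ∈ Ω, ξ z ∈ LoopU n)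
    (hsmooth : SmoothLoop Ω ξ) (hz : z ∈ Ω) (v : ℂ) (B : Loop) :
    (∀ l, fderiv ℝ (fun w => (ξ w).evalAt l) z v = ⁅(ξ z).evalAt l, B.evalAt l⁆) ↔
      ∀ k, fderiv ℝ (fun w => (ξ w).coeff k) z v = (⁅ξ z, B⁆ : Loop).coeff k := by
  simp only [← Loop.evalAt_lie]
  exact fderiv_evalAt_eq_iff hΩ (fun z hz _ => coeff_eq_zero_of_notMem_Icc (hmem z hz).1)
    hsmooth hz v _

/-- A polynomial Killing field: a smooth solution `ξ : Ω → Λ^n u(3)` of the Lax equation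
`dξ_λ = [ξ_λ, A_λ]`, not required to be twisted. -/
structure IsKillingField (Ω : Set ℂ) (A : Circle → ℂ → ℂ → M3) (n : ℕ) (ξ : ℂ → Loop) :
    Prop where
  mem : ∀ z ∈ Ω, ξ z ∈ LoopU n
  smooth : SmoothLoop Ω ξ
  lax : Lax Ω ξ A

theorem lax_gauge (hΩ : IsOpen Ω) (hmem : ∀ z ∈ Ω, ξ z ∈ LoopU n) (hsmooth : SmoothLoop Ω ξ)
    (hG : IsUnitaryGauge Ω G) (l : Circle) (hz : z ∈ Ω) (v : ℂ) :
    fderiv ℝ (fun w => (gaugeLoop ξ G w).evalAt l) z v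
        + ⁅gaugeA A G l z v, (gaugeLoop ξ G z).evalAt l⁆
      = (G z)⁻¹ * (fderiv ℝ (fun w => (ξ w).evalAt l) z v + ⁅A l z v, (ξ z).evalAt l⁆) * G z := by
  have hdiff := (hasFDerivAt_evalAt hΩ (fun z hz _ => coeff_eq_zero_of_notMem_Icc (hmem z hz).1)
    hsmooth hz l).differentiableAt
  simp only [evalAt_gaugeLoop, gaugeA]
  rw [fderiv_conj_apply hdiff (hG.differentiableAt hΩ hz) (hG.isUnit hz), mul_add, add_mul,
    conj_lie (hG.isUnit hz), ring_add_lie, ← ring_lie_skew ((G z)⁻¹ * (ξ z).evalAt l * G z)]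
  abel

namespace IsKillingField

theorem congr (hξ : IsKillingField Ω A n ξ) (hA : ∀ l, ∀ z ∈ Ω, ∀ v, A l z v = A' l z v) :
    IsKillingField Ω A' n ξ where
  mem := hξ.mem
  smooth := hξ.smooth
  lax l z hz v := hA l z hz v ▸ hξ.lax l z hz v

theorem gauge (hΩ : IsOpen Ω) (hξ : IsKillingField Ω A n ξ) (hG : IsUnitaryGauge Ω G) :
    IsKillingField Ω (gaugeA A G) n (gaugeLoop ξ G) where
  mem z hz := conj_mem_LoopU (hξ.mem z hz) (hG.unitary z hz)
  smooth := hξ.smooth.gauge hG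
  lax l z hz v := by
    have hcov := lax_gauge (A := A) hΩ hξ.mem hξ.smooth hG l hz v
    rw [hξ.lax l z hz v, ← ring_lie_skew ((ξ z).evalAt l), neg_add_cancel, mul_zero, zero_mul]
      at hcov
    rw [eq_neg_of_add_eq_zero_left hcov, ring_lie_skew]

end IsKillingField

end KillingFields

section GaugedFamilies

variable {Ω : Set ℂ} {F : Circle → ℂ → M3} {G : ℂ → M3} {z : ℂ}

theorem IsFamily.mc_gaugeF (hF : IsFamily Ω F) (hΩ : IsOpen Ω) (hG : IsUnitaryGauge Ω G)
    (l : Circle) (hz : z ∈ Ω) (v : ℂ) :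
    mc (gaugeF F G l) z v = gaugeA (fun m => mc (F m)) G l z v :=
  mc_mul ((hF.isUnitaryGauge l).differentiableAt hΩ hz) (hG.differentiableAt hΩ hz)
    ((hF.isUnitaryGauge l).isUnit hz) v

theorem deform_conj_add {g : M3} (hg : g ∈ U30) (A : ℂ → M3) {B : ℂ → M3}
    (hB : ∀ v, B v ∈ uC 0) (l : Circle) (v : ℂ) :
    deform (fun v => g⁻¹ * A v * g + B v) l v = g⁻¹ * deform A l v * g + B v := by
  have hcomp : ∀ a w, tauComp a (B w) = if 4 ∣ 0 - a then B w else 0 := fun a w =>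
    tauComp_of_mem_uC (hB w)
  have h0 : ∀ w, tauComp 0 (B w) = B w := fun w => by rw [hcomp, if_pos (by norm_num)]
  have h1 : ∀ w, tauComp 1 (B w) = 0 := fun w => by rw [hcomp, if_neg (by norm_num)]
  have h2 : ∀ w, tauComp 2 (B w) = 0 := fun w => by rw [hcomp, if_neg (by norm_num)]
  have h3 : ∀ w, tauComp (-1) (B w) = 0 := fun w => by rw [hcomp, if_neg (by norm_num)]
  simp only [deform, part10, part01, tauComp_add, tauComp_conj hg, h0, h1, h2, h3, add_zero,
    mul_add, add_mul, mul_sub, sub_mul, Matrix.mul_smul, Matrix.smul_mul]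
  abel

theorem IsLegendrianFraming.gauge {f : ℂ → M3} {u : ℂ → Fin 3 → ℂ}
    (hf : IsLegendrianFraming Ω f u) (hG : IsGauge Ω G) :
    IsLegendrianFraming Ω (fun z => f z * G z) u where
  smooth := hf.smooth.mul hG.1
  unitary z hz := mul_mem (hf.unitary z hz) (hG.2 z hz).1
  column z hz i := by
    rw [← hf.column z hz i, Matrix.mul_apply]
    simp only [apply_two_of_mem_U30 (hG.2 z hz)]
    rw [← Matrix.mul_apply, mul_one]
  det z hz := by rw [Matrix.det_mul, det_of_mem_U30 (hG.2 z hz), mul_one, hf.det z hz]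

theorem IsFamily.gauge (hF : IsFamily Ω F) (hΩ : IsOpen Ω) (hG : IsGauge Ω G) :
    IsFamily Ω (gaugeF F G) where
  smooth l := (hF.smooth l).mul hG.1
  unitary l z hz := mul_mem (hF.unitary l z hz) (hG.2 z hz).1
  twisted l z hz := by
    rw [gaugeF, tauGrp_mul, hF.twisted l z hz, (hG.2 z hz).2.1]
    rfl
  framing := by
    obtain ⟨u, hlift, hstat, hframe⟩ := hF.framing
    exact ⟨u, hlift, hstat, hframe.gauge hG⟩
  deformation l z hz v := by
    have hmc : ∀ l, mc (gaugeF F G l) z = fun w => (G z)⁻¹ * mc (F l) z w * G z + mc G z w :=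
      fun l => funext (hF.mc_gaugeF hΩ hG.isUnitaryGauge l hz)
    rw [hmc, hmc, deform_conj_add (hG.2 z hz) _ (mc_mem_uC_zero hΩ hG hz),
      ← hF.deformation l z hz]

end GaugedFamilies

section DeformedForm

variable {Ω : Set ℂ} {F : Circle → ℂ → M3} {z : ℂ}

theorem tauComp_one_of_skew {M : M3} (hM : Mᴴ = -M) : tauComp 1 M = -(tauComp (-1) M)ᴴ := by
  rw [tauComp_conjTranspose, hM, tauComp_neg, neg_neg, neg_neg]

theorem part01_tauComp_two_of_skew {A : ℂ → M3} (hA : ∀ v, (A v)ᴴ = -A v) (v : ℂ) :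
    part01 (fun w => tauComp 2 (A w)) v = -(part10 (fun w => tauComp 2 (A w)) v)ᴴ := by
  have hskew : ∀ w, (tauComp 2 (A w))ᴴ = -tauComp 2 (A w) := fun w => by
    rw [tauComp_conjTranspose, hA, tauComp_neg,
      tauComp_eq_of_dvd (show (4 : ℤ) ∣ -2 - 2 by norm_num)]
  simp only [part01, part10, Matrix.conjTranspose_smul, Matrix.conjTranspose_sub, hskew,
    Complex.star_def, Complex.conj_I, map_div₀, map_one, map_ofNat]
  module

/-- The form `A_2'`, i.e. the `dz`-part of the component of `A = f⁻¹ df` in `u(3)^ℂ_2`. -/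
def mcTwo (f : ℂ → M3) (z v : ℂ) : M3 := part10 (fun w => tauComp 2 (mc f z w)) v

/-- The Maurer--Cartan form at `z` as a linear map. -/
def mcLin (f : ℂ → M3) (z : ℂ) : ℂ →ₗ[ℝ] M3 :=
  LinearMap.mulLeft ℝ (f z)⁻¹ ∘ₗ (fderiv ℝ f z).toLinearMap

/-- The deformation `A_λ` of `A = f⁻¹ df` as a Laurent polynomial loop, for `U(3)`-valued `f`. -/
def mcLoop (f : ℂ → M3) (z v : ℂ) : Loop :=
  shortLoop (mcTwo f z v) (tauComp (-1) (mc f z v)) (tauComp 0 (mc f z v))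

theorem IsFamily.evalAt_mcLoop (hF : IsFamily Ω F) (hΩ : IsOpen Ω) (l : Circle) (hz : z ∈ Ω)
    (v : ℂ) : (mcLoop (F 1) z v).evalAt l = mc (F l) z v := by
  have hskew := conjTranspose_mc hΩ (hF.isUnitaryGauge 1) hz
  rw [hF.deformation l z hz v, deform, part01_tauComp_two_of_skew hskew,
    tauComp_one_of_skew (hskew v), mcLoop, evalAt_shortLoop, mcTwo]
  simp only [smul_neg, sub_eq_add_neg]

theorem evalAt_shortLoop_add (a b c d : M3) (l : Circle) :
    (shortLoop a b (c + d)).evalAt l = (shortLoop a b c).evalAt l + d := by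
  simp only [evalAt_shortLoop]
  abel

theorem IsFamily.forall_evalAt_projSu_eq_iff (hF : IsFamily Ω F) (hΩ : IsOpen Ω) (hz : z ∈ Ω)
    {p : ℕ} {ξ : Loop} (hξ : ξ ∈ LoopU (2 + 4 * p)) (v : ℂ) (X : M3) :
    (∀ l, (shifted p ξ v).projSu.evalAt l = mc (F l) z v + X) ↔
      v • ξ.coeff (-4 * (p : ℤ) - 2) = mcTwo (F 1) z v ∧
      v • ξ.coeff (-4 * (p : ℤ) - 1) = tauComp (-1) (mc (F 1) z v) ∧
      suPart (v • ξ.coeff (-4 * (p : ℤ))) = tauComp 0 (mc (F 1) z v) + X := by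
  have hmc : ∀ l, mc (F l) z v + X = (shortLoop (mcTwo (F 1) z v) (tauComp (-1) (mc (F 1) z v))
      (tauComp 0 (mc (F 1) z v) + X)).evalAt l := fun l =>
    (congrArg (· + X) (hF.evalAt_mcLoop hΩ l hz v)).symm.trans (evalAt_shortLoop_add ..).symm
  simp only [projSu_shifted hξ, hmc]
  exact ⟨fun h => shortLoop_inj (Loop.ext_evalAt h), fun ⟨ha, hb, hc⟩ l => by rw [ha, hb, hc]⟩

end DeformedForm

section Matched

/-- A polynomial Killing field `ξ` for `A_λ = F_λ⁻¹ dF_λ` such that the coefficients of `λ⁻²` and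
`λ⁻¹` in `λ^{4p} ξ_λ dz` are those of `A_λ`. This is what remains of `(λ^{4p} ξ_λ dz)_{Λsu} = A_λ`
when the values in `u(3)_0` are disregarded. -/
structure IsMatchedKillingField (Ω : Set ℂ) (F : Circle → ℂ → M3) (p : ℕ) (ξ : ℂ → Loop) : Prop
    extends IsKillingField Ω (fun l => mc (F l)) (2 + 4 * p) ξ where
  leading : ∀ z ∈ Ω, ∀ v, v • (ξ z).coeff (-4 * (p : ℤ) - 2) = mcTwo (F 1) z v
  subleading : ∀ z ∈ Ω, ∀ v, v • (ξ z).coeff (-4 * (p : ℤ) - 1) = tauComp (-1) (mc (F 1) z v)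

/-- The loops `ξ_λ` are twisted: `τ(ξ_λ) = ξ_{iλ}`, expressed through their coefficients. -/
def IsTwistedOn (Ω : Set ℂ) (ξ : ℂ → Loop) : Prop :=
  ∀ z ∈ Ω, ∀ k, (ξ z).coeff k ∈ uC k

variable {Ω : Set ℂ} {F : Circle → ℂ → M3} {p : ℕ} {ξ : ℂ → Loop} {z : ℂ}

theorem isQuasiAdapted_iff (hF : IsFamily Ω F) (hΩ : IsOpen Ω) :
    IsQuasiAdapted Ω F p ξ ↔ IsMatchedKillingField Ω F p ξ ∧ IsTwistedOn Ω ξ := by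
  constructor
  · rintro ⟨hmem, hsmooth, hlax, B, -, hB⟩
    have hcoeff := fun z hz v =>
      (hF.forall_evalAt_projSu_eq_iff hΩ hz (hmem z hz).1 v (B z v)).1 fun l => hB l z hz v
    exact ⟨⟨⟨fun z hz => (hmem z hz).1, hsmooth, hlax⟩, fun z hz v => (hcoeff z hz v).1,
      fun z hz v => (hcoeff z hz v).2.1⟩, fun z hz => (mem_LoopUTau_iff.1 (hmem z hz)).2⟩
  · rintro ⟨hξ, htw⟩
    let B : ℂ → ℂ →L[ℝ] M3 := fun z => LinearMap.toContinuousLinearMap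
      (suPartLin ∘ₗ (LinearMap.toSpanSingleton ℂ M3 ((ξ z).coeff (-4 * (p : ℤ)))).restrictScalars ℝ
        - (tauCompLin 0).restrictScalars ℝ ∘ₗ mcLin (F 1) z)
    have hB : ∀ z v, B z v
        = suPart (v • (ξ z).coeff (-4 * (p : ℤ))) - tauComp 0 (mc (F 1) z v) := fun _ _ => rfl
    refine ⟨fun z hz => mem_LoopUTau_iff.2 ⟨hξ.mem z hz, htw z hz⟩, hξ.smooth, hξ.lax, B,
      fun z hz v => ?_, fun l z hz v => ?_⟩
    · have hmem := uC_eq_of_dvd (show (4 : ℤ) ∣ -4 * (p : ℤ) - 0 by omega) ▸ htw z hz _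
      exact hB z v ▸ sub_mem_uC (suPart_mem (smul_mem_uC v hmem)).1 (tauComp_mem 0 _)
    · refine (hF.forall_evalAt_projSu_eq_iff hΩ hz (hξ.mem z hz) v _).2
        ⟨hξ.leading z hz v, hξ.subleading z hz v, ?_⟩ l
      rw [hB, add_sub_cancel]

namespace IsMatchedKillingField

theorem isAdapted (hξ : IsMatchedKillingField Ω F p ξ) (hF : IsFamily Ω F) (hΩ : IsOpen Ω)
    (htw : IsTwistedOn Ω ξ) (hzero : ∀ z ∈ Ω, ∀ v,
      suPart (v • (ξ z).coeff (-4 * (p : ℤ))) = tauComp 0 (mc (F 1) z v)) :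
    IsAdapted Ω F p ξ where
  mem z hz := mem_LoopUTau_iff.2 ⟨hξ.mem z hz, htw z hz⟩
  smooth := hξ.smooth
  lax := hξ.lax
  adapted l z hz v := by
    rw [← add_zero (mc (F l) z v)]
    exact (hF.forall_evalAt_projSu_eq_iff hΩ hz (hξ.mem z hz) v 0).2
      ⟨hξ.leading z hz v, hξ.subleading z hz v, by rw [hzero z hz v, add_zero]⟩ l

theorem gauge {G : ℂ → M3} (hξ : IsMatchedKillingField Ω F p ξ) (hF : IsFamily Ω F)
    (hΩ : IsOpen Ω) (hG : IsGauge Ω G) :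
    IsMatchedKillingField Ω (gaugeF F G) p (gaugeLoop ξ G) := by
  have hmc : ∀ l, ∀ z ∈ Ω, ∀ v, gaugeA (fun m => mc (F m)) G l z v = mc (gaugeF F G l) z v :=
    fun l z hz v => (hF.mc_gaugeF hΩ hG.isUnitaryGauge l hz v).symm
  have hcomp : ∀ a : ℤ, ¬ (4 : ℤ) ∣ 0 - a → ∀ z ∈ Ω, ∀ w, tauComp a (mc (gaugeF F G 1) z w) =
      (G z)⁻¹ * tauComp a (mc (F 1) z w) * G z := fun a ha z hz w => by
    have hzero : tauComp a ((G z)⁻¹ * fderiv ℝ G z w) = 0 :=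
      (tauComp_of_mem_uC (mc_mem_uC_zero hΩ hG hz w)).trans (if_neg ha)
    rw [hF.mc_gaugeF hΩ hG.isUnitaryGauge 1 hz w, gaugeA, tauComp_add, tauComp_conj (hG.2 z hz),
      hzero, add_zero]
  refine ⟨(hξ.toIsKillingField.gauge hΩ hG.isUnitaryGauge).congr hmc, fun z hz v => ?_,
    fun z hz v => ?_⟩
  · rw [coeff_gaugeLoop, ← smul_mul_assoc, ← mul_smul_comm, hξ.leading z hz v]
    simp only [mcTwo, hcomp 2 (by norm_num) z hz, part10, mul_sub, sub_mul, mul_smul_comm,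
      smul_mul_assoc]
  · rw [coeff_gaugeLoop, ← smul_mul_assoc, ← mul_smul_comm, hξ.subleading z hz v,
      hcomp (-1) (by norm_num) z hz]

theorem fderiv_coeff_apply (hξ : IsMatchedKillingField Ω F p ξ) (hF : IsFamily Ω F)
    (hΩ : IsOpen Ω) (hz : z ∈ Ω) (k : ℤ) (v : ℂ) :
    fderiv ℝ (fun w => (ξ w).coeff k) z v =
      ⁅(ξ z).coeff (k + 2), v • (ξ z).coeff (-4 * (p : ℤ) - 2)⁆
        + ⁅(ξ z).coeff (k + 1), v • (ξ z).coeff (-4 * (p : ℤ) - 1)⁆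
        + ⁅(ξ z).coeff k, tauComp 0 (mc (F 1) z v)⁆
        - ⁅(ξ z).coeff (k - 1), (v • (ξ z).coeff (-4 * (p : ℤ) - 1))ᴴ⁆
        - ⁅(ξ z).coeff (k - 2), (v • (ξ z).coeff (-4 * (p : ℤ) - 2))ᴴ⁆ := by
  rw [hξ.leading z hz, hξ.subleading z hz, ← coeff_lie_shortLoop]
  refine (fderiv_evalAt_eq_lie_iff hΩ hξ.mem hξ.smooth hz v (mcLoop (F 1) z v)).1 (fun l => ?_) k
  rw [hF.evalAt_mcLoop hΩ l hz v]
  exact hξ.lax l z hz v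

end IsMatchedKillingField

end Matched

section TwistedCoefficients

variable {Ω : Set ℂ} {ξ : ℂ → Loop} {z : ℂ} (htw : IsTwistedOn Ω ξ) (hz : z ∈ Ω) (p : ℕ)
include htw hz

theorem IsTwistedOn.coeff_mem_uC_two : (ξ z).coeff (-4 * (p : ℤ) - 2) ∈ uC 2 :=
  uC_eq_of_dvd (show (4 : ℤ) ∣ -4 * (p : ℤ) - 2 - 2 by omega) ▸ htw z hz _

theorem IsTwistedOn.coeff_mem_uC_zero : (ξ z).coeff (-4 * (p : ℤ)) ∈ uC 0 :=
  uC_eq_of_dvd (show (4 : ℤ) ∣ -4 * (p : ℤ) - 0 by omega) ▸ htw z hz _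

end TwistedCoefficients

section ConstantLeadingCoefficient

variable {Ω : Set ℂ} {F : Circle → ℂ → M3} {p : ℕ} {ξ : ℂ → Loop} {z : ℂ}

theorem tauComp_two_apply_two_two (M : M3) : tauComp 2 M 2 2 = M 2 2 := by
  have hzero : tauComp 0 M 2 2 = 0 := by
    rw [eq_of_mem_uC_zero (tauComp_mem 0 M)]
    rfl
  have hsum := congrArg (fun N : M3 => N 2 2) (tauComp_sum M)
  simpa only [Matrix.add_apply, hzero,
    apply_two_two_of_mem_uC_of_odd (tauComp_mem 1 M) odd_one,
    apply_two_two_of_mem_uC_of_odd (tauComp_mem (-1) M) odd_neg_one, add_zero] using hsum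

theorem IsFamily.mc_apply_two_two (hF : IsFamily Ω F) (hΩ : IsOpen Ω) (hz : z ∈ Ω) {v : ℂ}
    (hv : v = 1 ∨ v = Complex.I) : mc (F 1) z v 2 2 = 0 := by
  obtain ⟨u, hu, -, hframe⟩ := hF.framing
  have hdF := (hF.isUnitaryGauge 1).differentiableAt hΩ hz
  have hdu := differentiableAt_of_contDiffOn hΩ hu.smooth hz
  have hcol : ∀ i, fderiv ℝ (F 1) z v i 2 = fderiv ℝ u z v i := fun i => by
    have hcongr : (fun w => F 1 w i 2) =ᶠ[nhds z] fun w => u w i := by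
      filter_upwards [hΩ.mem_nhds hz] with w hw using hframe.column w hw i
    rw [← fderiv_entry_apply hdF, hcongr.fderiv_eq, fderiv_apply hdu i]
    rfl
  have hhor : ∑ i, star (u z i) * fderiv ℝ u z v i = 0 := by
    rcases hv with rfl | rfl
    exacts [(hu.horizontal z hz).1, (hu.horizontal z hz).2]
  rw [mc, inv_eq_conjTranspose_of_mem_unitaryGroup (hframe.unitary z hz), Matrix.mul_apply]
  simpa only [Matrix.conjTranspose_apply, hframe.column z hz, hcol] using hhor

namespace IsMatchedKillingField

variable (hξ : IsMatchedKillingField Ω F p ξ) (hF : IsFamily Ω F) (hΩ : IsOpen Ω)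
include hξ hF hΩ

theorem leading_apply_two_two (hz : z ∈ Ω) : (ξ z).coeff (-4 * (p : ℤ) - 2) 2 2 = 0 := by
  rw [← one_smul ℂ ((ξ z).coeff (-4 * (p : ℤ) - 2)), hξ.leading z hz, mcTwo, part10]
  simp only [Matrix.smul_apply, Matrix.sub_apply, tauComp_two_apply_two_two,
    hF.mc_apply_two_two hΩ hz (.inl rfl), hF.mc_apply_two_two hΩ hz (.inr rfl), smul_zero,
    sub_zero]

theorem fderiv_leading_eq_zero (htw : IsTwistedOn Ω ξ) (hz : z ∈ Ω) (v : ℂ) :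
    fderiv ℝ (fun w => (ξ w).coeff (-4 * (p : ℤ) - 2)) z v = 0 := by
  have hlow : ∀ k < -4 * (p : ℤ) - 2, (ξ z).coeff k = 0 := fun k hk =>
    (hξ.mem z hz).1 k (by rw [lt_abs]; push_cast; omega)
  have ha := htw.coeff_mem_uC_two hz p
  have hcomm : ∀ M : M3, ⁅M, v • M⁆ = 0 := fun M => by
    rw [Ring.lie_def, mul_smul_comm, smul_mul_assoc, sub_self]
  rw [hξ.fderiv_coeff_apply hF hΩ hz, hlow (-4 * (p : ℤ) - 2 - 1) (by omega),
    hlow (-4 * (p : ℤ) - 2 - 2) (by omega), show -4 * (p : ℤ) - 2 + 2 = -4 * (p : ℤ) by ring,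
    show -4 * (p : ℤ) - 2 + 1 = -4 * (p : ℤ) - 1 by ring, hcomm,
    lie_eq_zero_of_mem_uC_zero_two (htw.coeff_mem_uC_zero hz p) (smul_mem_uC v ha),
    ← ring_lie_skew ((ξ z).coeff (-4 * (p : ℤ) - 2)),
    lie_eq_zero_of_mem_uC_zero_two (tauComp_mem 0 _) ha]
  simp [Ring.lie_def]

theorem hasConstLeading (htw : IsTwistedOn Ω ξ) (hsc : IsSimplyConnected Ω) :
    HasConstLeading Ω p ξ := by
  obtain ⟨z₀, hz₀⟩ := hsc.nonempty
  let c : ℂ → M3 := fun z => (ξ z).coeff (-4 * (p : ℤ) - 2)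
  have hconst : ∀ z ∈ Ω, c z = c z₀ := fun z hz =>
    hΩ.is_const_of_fderiv_eq_zero (𝕜 := ℝ) hsc.isPathConnected.isConnected.isPreconnected
      (fun w hw => (differentiableAt_of_contDiffOn hΩ (hξ.smooth _) hw).differentiableWithinAt)
      (fun w hw => ContinuousLinearMap.ext (hξ.fderiv_leading_eq_zero hF hΩ htw hw)) hz hz₀
  refine ⟨-Complex.I * c z₀ 0 0, fun z hz => ?_⟩
  have hI : Complex.I * (-Complex.I * c z₀ 0 0) = c z₀ 0 0 := by
    rw [← mul_assoc, mul_neg, Complex.I_mul_I, neg_neg, one_mul]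
  rw [hI]
  refine (hconst z hz).trans ((eq_of_mem_uC_two (htw.coeff_mem_uC_two hz₀ p)).trans ?_)
  rw [hξ.leading_apply_two_two hF hΩ hz₀]

end IsMatchedKillingField

end ConstantLeadingCoefficient

section ZeroForm

/-- The form `A_0 - ξ̂_{-4p} dz` with values in `u(3)^ℂ_0 ≅ sl(2, ℂ)`. The gauge that turns a
quasi-adapted `ξ` into an adapted one has to make it take values in `𝔟`. -/
def zeroForm (F : Circle → ℂ → M3) (p : ℕ) (ξ : ℂ → Loop) (z : ℂ) : ℂ →ₗ[ℝ] M3 :=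
  (tauCompLin 0).restrictScalars ℝ ∘ₗ mcLin (F 1) z
    - (LinearMap.toSpanSingleton ℂ M3 ((ξ z).coeff (-4 * (p : ℤ)))).restrictScalars ℝ

theorem zeroForm_apply (F : Circle → ℂ → M3) (p : ℕ) (ξ : ℂ → Loop) (z v : ℂ) :
    zeroForm F p ξ z v = tauComp 0 (mc (F 1) z v) - v • (ξ z).coeff (-4 * (p : ℤ)) :=
  rfl

namespace IsMatchedKillingField

variable {Ω : Set ℂ} {F : Circle → ℂ → M3} {p : ℕ} {ξ : ℂ → Loop} {z : ℂ}
  (hξ : IsMatchedKillingField Ω F p ξ) (hF : IsFamily Ω F) (hΩ : IsOpen Ω)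
include hξ hF hΩ

theorem structure_equation_zero (hz : z ∈ Ω) (u v : ℂ) :
    tauComp 0 (fderiv ℝ (fun w => mc (F 1) w v) z u)
      - tauComp 0 (fderiv ℝ (fun w => mc (F 1) w u) z v)
      + ⁅tauComp 0 (mc (F 1) z u), tauComp 0 (mc (F 1) z v)⁆
      + (star u * v - u * star v) •
        ⁅(ξ z).coeff (-4 * (p : ℤ) - 1), ((ξ z).coeff (-4 * (p : ℤ) - 1))ᴴ⁆ = 0 := by
  have hskew := conjTranspose_mc hΩ (hF.isUnitaryGauge 1) hz
  have hstr := congrArg (tauCompLin 0)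
    (mc_structure_equation hΩ (hF.isUnitaryGauge 1) hz u v)
  rw [map_zero] at hstr
  change tauComp 0 _ = 0 at hstr
  rw [tauComp_add, tauComp_sub, tauComp_zero_lie,
    lie_eq_zero_of_mem_uC_two (tauComp_mem 2 _) (tauComp_mem 2 _), tauComp_one_of_skew (hskew u),
    tauComp_one_of_skew (hskew v), ← hξ.subleading z hz, ← hξ.subleading z hz] at hstr
  rw [← hstr]
  simp only [Ring.lie_def, Matrix.conjTranspose_smul, smul_mul_assoc, mul_smul_comm, neg_mul,
    mul_neg]
  module

theorem fderiv_zero_coeff (htw : IsTwistedOn Ω ξ) (hz : z ∈ Ω) (u v : ℂ) :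
    v • fderiv ℝ (fun w => (ξ w).coeff (-4 * (p : ℤ))) z u
      - u • fderiv ℝ (fun w => (ξ w).coeff (-4 * (p : ℤ))) z v =
    v • ⁅(ξ z).coeff (-4 * (p : ℤ)), tauComp 0 (mc (F 1) z u)⁆
      - u • ⁅(ξ z).coeff (-4 * (p : ℤ)), tauComp 0 (mc (F 1) z v)⁆
      - (star u * v - u * star v) •
        ⁅(ξ z).coeff (-4 * (p : ℤ) - 1), ((ξ z).coeff (-4 * (p : ℤ) - 1))ᴴ⁆ := by
  have ha := htw.coeff_mem_uC_two hz p
  have hcomm : ∀ v : ℂ, ⁅(ξ z).coeff (-4 * (p : ℤ) - 2),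
      (v • (ξ z).coeff (-4 * (p : ℤ) - 2))ᴴ⁆ = 0 := fun v =>
    lie_eq_zero_of_mem_uC_two ha (uC_eq_of_dvd (show (4 : ℤ) ∣ -2 - 2 by norm_num) ▸
      conjTranspose_mem_uC (smul_mem_uC v ha))
  rw [hξ.fderiv_coeff_apply hF hΩ hz, hξ.fderiv_coeff_apply hF hΩ hz, hcomm, hcomm]
  simp only [Ring.lie_def, Matrix.conjTranspose_smul, smul_mul_assoc, mul_smul_comm, smul_sub]
  module

theorem contDiffOn_zeroForm (v : ℂ) : ContDiffOn ℝ ∞ (fun w => zeroForm F p ξ w v) Ω :=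
  (contDiffOn_linearMap_comp ((tauCompLin 0).restrictScalars ℝ)
    (contDiffOn_mc hΩ (hF.isUnitaryGauge 1) v)).sub ((hξ.smooth _).const_smul v)

theorem fderiv_zeroForm_apply (hz : z ∈ Ω) (u v : ℂ) :
    fderiv ℝ (fun w => zeroForm F p ξ w v) z u =
      tauComp 0 (fderiv ℝ (fun w => mc (F 1) w v) z u)
        - v • fderiv ℝ (fun w => (ξ w).coeff (-4 * (p : ℤ))) z u := by
  have hmc := differentiableAt_of_contDiffOn hΩ (contDiffOn_mc hΩ (hF.isUnitaryGauge 1) v) hz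
  have hzero := ((tauCompLin 0).restrictScalars ℝ).toContinuousLinearMap.hasFDerivAt.comp z
    hmc.hasFDerivAt
  have hcoeff := differentiableAt_of_contDiffOn hΩ (hξ.smooth (-4 * (p : ℤ))) hz
  exact DFunLike.congr_fun (hzero.sub (hcoeff.hasFDerivAt.const_smul v)).fderiv u

theorem zeroForm_flat (htw : IsTwistedOn Ω ξ) (hz : z ∈ Ω) (u v : ℂ) :
    fderiv ℝ (fun w => zeroForm F p ξ w v) z u - fderiv ℝ (fun w => zeroForm F p ξ w u) z v
      + ⁅zeroForm F p ξ z u, zeroForm F p ξ z v⁆ = 0 := by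
  rw [hξ.fderiv_zeroForm_apply hF hΩ hz, hξ.fderiv_zeroForm_apply hF hΩ hz,
    sub_sub_sub_comm, hξ.fderiv_zero_coeff hF hΩ htw hz u v,
    ← hξ.structure_equation_zero hF hΩ hz u v]
  simp only [zeroForm_apply, Ring.lie_def, mul_sub, sub_mul, smul_mul_assoc, mul_smul_comm,
    smul_sub]
  module

end IsMatchedKillingField

end ZeroForm

section BorelGauge

theorem mem_borel_of_mem_uC_zero {M : M3} (hM : M ∈ uC 0) (h01 : M 0 1 = 0) {t : ℝ}
    (h11 : M 1 1 = t) : M ∈ borel := by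
  have hM' := eq_of_mem_uC_zero hM
  have h00 : M 0 0 = ((-t : ℝ) : ℂ) := by
    have hdiag : M 1 1 = -M 0 0 := congrFun (congrFun hM' 1) 1
    rw [Complex.ofReal_neg, ← h11, hdiag, neg_neg]
  exact ⟨-t, M 1 0, hM'.trans (by rw [h01, h00])⟩

/-- The norm of the upper part of the column of index `1`. -/
def colNorm (X : M3) : ℝ := √(Complex.normSq (X 0 1) + Complex.normSq (X 1 1))

/-- The element of `U(3)_0` whose column of index `1` is the normalization of that of `X`, for
invertible `X` with `X 2 1 = 0`. -/
def suOfColumn (X : M3) : M3 := suMat (((colNorm X)⁻¹ • X) 0 1) (((colNorm X)⁻¹ • X) 1 1)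

theorem colNorm_pos {X : M3} (hX : IsUnit X) (h : X 2 1 = 0) : 0 < colNorm X := by
  by_contra hn
  have hsum : Complex.normSq (X 0 1) + Complex.normSq (X 1 1) ≤ 0 := by
    simpa only [colNorm, Real.sqrt_pos, not_lt] using hn
  have hnonneg := fun i => Complex.normSq_nonneg (X i 1)
  have h0 : X 0 1 = 0 := Complex.normSq_eq_zero.1 (by linarith [hnonneg 0, hnonneg 1])
  have h1 : X 1 1 = 0 := Complex.normSq_eq_zero.1 (by linarith [hnonneg 0, hnonneg 1])
  have hcol : ∀ i, X i 1 = 0 := by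
    intro i
    fin_cases i
    exacts [h0, h1, h]
  exact ((Matrix.isUnit_iff_isUnit_det _).1 hX).ne_zero
    (Matrix.det_eq_zero_of_column_eq_zero 1 hcol)

theorem suOfColumn_one : suOfColumn 1 = 1 := by
  ext i j
  fin_cases i <;> fin_cases j <;> simp [suOfColumn, suMat, colNorm]

theorem suOfColumn_apply_one {X : M3} (h : X 2 1 = 0) (i : Fin 3) :
    suOfColumn X i 1 = (colNorm X)⁻¹ • X i 1 := by
  fin_cases i <;> simp [suOfColumn, suMat, h]

theorem suOfColumn_mem {X : M3} (h : 0 < colNorm X) : suOfColumn X ∈ U30 := by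
  apply suMat_mem
  have hsq : (colNorm X : ℂ) ^ 2 = star (X 0 1) * X 0 1 + star (X 1 1) * X 1 1 := by
    simp only [Complex.star_def, ← Complex.normSq_eq_conj_mul_self]
    exact_mod_cast Real.sq_sqrt (Real.sqrt_pos.1 h).le
  have hne : ((colNorm X : ℝ) : ℂ) ≠ 0 := by exact_mod_cast h.ne'
  simp only [Matrix.smul_apply, Complex.real_smul, star_mul', Complex.star_def,
    Complex.conj_ofReal] at hsq ⊢
  push_cast
  field_simp
  linear_combination -hsq

variable {Ω : Set ℂ} {K : ℂ → M3}

theorem contDiffOn_inv_colNorm (hK : ContDiffOn ℝ ∞ K Ω) (hpos : ∀ z ∈ Ω, 0 < colNorm (K z)) :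
    ContDiffOn ℝ ∞ (fun z => (colNorm (K z))⁻¹) Ω := by
  have hnormSq : ∀ i, ContDiffOn ℝ ∞ (fun z => Complex.normSq (K z i 1)) Ω := fun i => by
    have hre := Complex.reCLM.contDiff.comp_contDiffOn (contDiffOn_entry hK i 1)
    have him := Complex.imCLM.contDiff.comp_contDiffOn (contDiffOn_entry hK i 1)
    exact (hre.mul hre).add (him.mul him)
  exact (((hnormSq 0).add (hnormSq 1)).sqrt fun z hz => (Real.sqrt_pos.1 (hpos z hz)).ne').inv
    fun z hz => (hpos z hz).ne'

theorem isGauge_suOfColumn (hK : ContDiffOn ℝ ∞ K Ω) (hpos : ∀ z ∈ Ω, 0 < colNorm (K z)) :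
    IsGauge Ω fun z => suOfColumn (K z) := by
  let L : M3 →ₗ[ℝ] M3 :=
    { toFun := fun X => !![star (X 1 1), X 0 1, 0; -star (X 0 1), X 1 1, 0; 0, 0, 0]
      map_add' := fun X Y => by ext i j; fin_cases i <;> fin_cases j <;> simp [add_comm]
      map_smul' := fun r X => by ext i j; fin_cases i <;> fin_cases j <;> simp }
  have hL : ∀ z, suOfColumn (K z) = L ((colNorm (K z))⁻¹ • K z) + suMat 0 0 := fun z => by
    ext i j
    fin_cases i <;> fin_cases j <;> simp [suOfColumn, suMat, L]
  refine ⟨?_, fun z hz => suOfColumn_mem (hpos z hz)⟩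
  simp only [hL]
  exact (contDiffOn_linearMap_comp L ((contDiffOn_inv_colNorm hK hpos).smul hK)).add
    contDiffOn_const

theorem frame_apply_two_one {θ : ℂ → ℂ → M3} (hΩ : IsOpen Ω) (hpre : IsPreconnected Ω)
    (hK : ContDiffOn ℝ ∞ K Ω) (hθ : ∀ z ∈ Ω, ∀ v, θ z v ∈ uC 0)
    (hd : ∀ z ∈ Ω, ∀ v, fderiv ℝ K z v = θ z v * K z) {z₀ : ℂ} (hz₀ : z₀ ∈ Ω) (h1 : K z₀ = 1)
    {z : ℂ} (hz : z ∈ Ω) : K z 2 1 = 0 := by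
  have hdiff : ∀ w ∈ Ω, DifferentiableAt ℝ (fun w => K w 2 1) w := fun w hw =>
    differentiableAt_of_contDiffOn hΩ (contDiffOn_entry hK 2 1) hw
  have hderiv : ∀ w ∈ Ω, fderiv ℝ (fun w => K w 2 1) w = 0 := fun w hw => by
    ext1 v
    rw [fderiv_entry_apply (differentiableAt_of_contDiffOn hΩ hK hw), hd w hw v,
      eq_of_mem_uC_zero (hθ w hw v), Matrix.mul_apply, Fin.sum_univ_three]
    simp
  rw [hΩ.is_const_of_fderiv_eq_zero (𝕜 := ℝ) hpre
    (fun w hw => (hdiff w hw).differentiableWithinAt) hderiv hz hz₀, h1]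
  rfl

theorem conj_add_mc_apply {G : ℂ → M3} {r : ℂ → ℝ} {z v : ℂ} {T : M3} {j : Fin 3}
    (hK : DifferentiableAt ℝ K z) (hG : DifferentiableAt ℝ G z) (hr : DifferentiableAt ℝ r z)
    (hd : fderiv ℝ K z v = -(T * K z)) (hcol : ∀ᶠ w in nhds z, ∀ i, G w i j = r w • K w i j)
    (hu : IsUnit (G z)) (hr0 : r z ≠ 0) (i : Fin 3) :
    ((G z)⁻¹ * T * G z + mc G z v) i j = (fderiv ℝ r z v / r z) • (1 : M3) i j := by
  have hdK : ∀ i, DifferentiableAt ℝ (fun w => K w i j) z := fun i =>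
    (LinearMap.toContinuousLinearMap (Matrix.entryLinearMap ℝ ℂ i j)).differentiableAt.comp z hK
  have hcongr : ∀ i, (fun w => G w i j) =ᶠ[nhds z] fun w => r w • K w i j := fun i =>
    hcol.mono fun w hw => hw i
  have hdG : ∀ i, fderiv ℝ G z v i j = fderiv ℝ r z v • K z i j - r z • (T * K z) i j :=
    fun i => by
      rw [← fderiv_entry_apply hG, (hcongr i).fderiv_eq,
        fderiv_fun_smul hr (hdK i)]
      change r z • fderiv ℝ (fun w => K w i j) z v + fderiv ℝ r z v • K z i j = _
      rw [fderiv_entry_apply hK, hd, Matrix.neg_apply, smul_neg]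
      abel
  have hTG : ∀ i, (T * G z) i j = r z • (T * K z) i j := fun i => by
    simp only [Matrix.mul_apply, hcol.self_of_nhds, Finset.smul_sum, mul_smul_comm]
  have hsum : ∀ i, (T * G z + fderiv ℝ G z v) i j = (fderiv ℝ r z v / r z) • G z i j := fun i => by
    rw [Matrix.add_apply, hdG, hTG, hcol.self_of_nhds, smul_smul, div_mul_cancel₀ _ hr0]
    abel
  rw [mc, mul_assoc, ← mul_add, ← Matrix.nonsing_inv_mul _ ((Matrix.isUnit_iff_isUnit_det _).1 hu),
    Matrix.mul_apply, Matrix.mul_apply, Finset.smul_sum]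
  exact Finset.sum_congr rfl fun k _ => by rw [hsum, mul_smul_comm]

theorem exists_gauge_borel {θ : ℂ → ℂ →ₗ[ℝ] M3} (hΩ : IsOpen Ω) (hsc : IsSimplyConnected Ω)
    {z₀ : ℂ} (hz₀ : z₀ ∈ Ω) (hmem : ∀ z ∈ Ω, ∀ v, θ z v ∈ uC 0)
    (hθ : ∀ v, ContDiffOn ℝ ∞ (fun z => θ z v) Ω)
    (hflat : ∀ z ∈ Ω, ∀ u v, fderiv ℝ (fun w => θ w v) z u - fderiv ℝ (fun w => θ w u) z v
      + ⁅θ z u, θ z v⁆ = 0) :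
    ∃ G, IsGauge Ω G ∧ G z₀ = 1 ∧ ∀ z ∈ Ω, ∀ v, (G z)⁻¹ * θ z v * G z + mc G z v ∈ borel := by
  have hdneg : ∀ z u v, fderiv ℝ (fun w => -θ w v) z u = -fderiv ℝ (fun w => θ w v) z u :=
    fun z u v => DFunLike.congr_fun (fderiv_fun_neg (f := fun w => θ w v)) u
  have hflat' : ∀ z ∈ Ω, ∀ u v, fderiv ℝ (fun w => -θ w v) z u + -θ z v * -θ z u =
      fderiv ℝ (fun w => -θ w u) z v + -θ z u * -θ z v := fun z hz u v => by
    rw [hdneg, hdneg, neg_mul_neg, neg_mul_neg, ← sub_eq_zero, ← neg_eq_zero, ← hflat z hz u v,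
      Ring.lie_def]
    abel
  obtain ⟨K, hK₀, hK, hframe⟩ := exists_frame_of_linearMap (𝔸 := M3) (θ := fun z => -θ z) hΩ hsc
    (fun v => (hθ v).neg) hflat' hz₀
  have hd : ∀ z ∈ Ω, ∀ v, fderiv ℝ K z v = -θ z v * K z := fun z hz => (hframe z hz).2
  have h21 : ∀ z ∈ Ω, K z 2 1 = 0 := fun z hz => frame_apply_two_one hΩ
    hsc.isPathConnected.isConnected.isPreconnected hK (fun z hz v => neg_mem_uC (hmem z hz v)) hd
    hz₀ hK₀ hz
  have hpos : ∀ z ∈ Ω, 0 < colNorm (K z) := fun z hz => colNorm_pos (hframe z hz).1 (h21 z hz)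
  have hG := isGauge_suOfColumn hK hpos
  refine ⟨_, hG, hK₀.symm ▸ suOfColumn_one, fun z hz v => ?_⟩
  have hcol : ∀ᶠ w in nhds z, ∀ i, suOfColumn (K w) i 1 = (colNorm (K w))⁻¹ • K w i 1 := by
    filter_upwards [hΩ.mem_nhds hz] with w hw using suOfColumn_apply_one (h21 w hw)
  have hentry := conj_add_mc_apply (differentiableAt_of_contDiffOn hΩ hK hz)
    (differentiableAt_of_contDiffOn hΩ hG.1 hz)
    (differentiableAt_of_contDiffOn hΩ (contDiffOn_inv_colNorm hK hpos) hz)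
    ((hd z hz v).trans (neg_mul _ _)) hcol (hG.isUnitaryGauge.isUnit hz)
    (inv_ne_zero (hpos z hz).ne')
  refine mem_borel_of_mem_uC_zero
    (t := fderiv ℝ (fun w => (colNorm (K w))⁻¹) z v / (colNorm (K z))⁻¹)
    (add_mem_uC (conj_mem_uC (hG.2 z hz) (hmem z hz v)) (mc_mem_uC_zero hΩ hG hz v))
    ((hentry 0).trans ?_) ((hentry 1).trans ?_)
  · simp
  · simp

end BorelGauge

section Adapted

variable {Ω : Set ℂ} {F : Circle → ℂ → M3} {p : ℕ} {ξ : ℂ → Loop} {z : ℂ}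

theorem IsTwistedOn.gauge {G : ℂ → M3} (htw : IsTwistedOn Ω ξ) (hG : IsGauge Ω G) :
    IsTwistedOn Ω (gaugeLoop ξ G) := fun z hz k => by
  rw [coeff_gaugeLoop]
  exact conj_mem_uC (hG.2 z hz) (htw z hz k)

theorem zeroForm_gauge {G : ℂ → M3} (hF : IsFamily Ω F) (hΩ : IsOpen Ω) (hG : IsGauge Ω G)
    (hz : z ∈ Ω) (v : ℂ) : zeroForm (gaugeF F G) p (gaugeLoop ξ G) z v =
      (G z)⁻¹ * zeroForm F p ξ z v * G z + mc G z v := by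
  rw [zeroForm_apply, zeroForm_apply, hF.mc_gaugeF hΩ hG.isUnitaryGauge 1 hz v, gaugeA, tauComp_add,
    tauComp_conj (hG.2 z hz), coeff_gaugeLoop]
  have hmc : tauComp 0 ((G z)⁻¹ * fderiv ℝ G z v) = mc G z v :=
    (tauComp_of_mem_uC (mc_mem_uC_zero hΩ hG hz v)).trans (if_pos (by norm_num))
  rw [hmc, mul_sub, sub_mul, mul_smul_comm, smul_mul_assoc]
  abel

theorem IsMatchedKillingField.exists_gauge_isAdapted (hξ : IsMatchedKillingField Ω F p ξ)
    (hF : IsFamily Ω F) (hΩ : IsOpen Ω) (hsc : IsSimplyConnected Ω) (htw : IsTwistedOn Ω ξ)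
    {z₀ : ℂ} (hz₀ : z₀ ∈ Ω) :
    ∃ G, IsGauge Ω G ∧ G z₀ = 1 ∧ IsAdapted Ω (gaugeF F G) p (gaugeLoop ξ G) := by
  obtain ⟨G, hG, hG₀, hborel⟩ := exists_gauge_borel (θ := zeroForm F p ξ) hΩ hsc hz₀
    (fun z hz v => sub_mem_uC (tauComp_mem 0 _) (smul_mem_uC v (htw.coeff_mem_uC_zero hz p)))
    (hξ.contDiffOn_zeroForm hF hΩ) (fun z hz => hξ.zeroForm_flat hF hΩ htw hz)
  have hFG := hF.gauge hΩ hG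
  refine ⟨G, hG, hG₀, (hξ.gauge hF hΩ hG).isAdapted hFG hΩ (htw.gauge hG) fun z hz v => ?_⟩
  have hskew : (tauComp 0 (mc (gaugeF F G 1) z v))ᴴ = -tauComp 0 (mc (gaugeF F G 1) z v) := by
    rw [tauComp_conjTranspose, conjTranspose_mc hΩ (hFG.isUnitaryGauge 1) hz, tauComp_neg, neg_zero]
  rw [← sub_sub_cancel (tauComp 0 (mc (gaugeF F G 1) z v))
    (v • (gaugeLoop ξ G z).coeff (-4 * (p : ℤ))), ← zeroForm_apply, zeroForm_gauge hF hΩ hG hz]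
  exact suPart_sub_of_mem_borel (tauComp_mem 0 _) hskew (hborel z hz v)

end Adapted

section QuasiFiniteType

variable {Ω : Set ℂ} {F F' : Circle → ℂ → M3} {p : ℕ} {ξ : ℂ → Loop}

theorem IsAdapted.isQuasiAdapted (hξ : IsAdapted Ω F p ξ) : IsQuasiAdapted Ω F p ξ where
  mem := hξ.mem
  smooth := hξ.smooth
  lax := hξ.lax
  adapted := ⟨0, fun _ _ _ => mem_uCSubmodule_iff.1 (Submodule.zero_mem _), fun l z hz v =>
    (hξ.adapted l z hz v).trans (add_zero _).symm⟩

theorem IsMatchedKillingField.congr (hξ : IsMatchedKillingField Ω F p ξ) (hΩ : IsOpen Ω)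
    (h : ∀ l, Set.EqOn (F l) (F' l) Ω) : IsMatchedKillingField Ω F' p ξ where
  toIsKillingField := hξ.toIsKillingField.congr fun l _ hz v => mc_congr hΩ (h l) hz v
  leading z hz v := (hξ.leading z hz v).trans <| by
    rw [mcTwo, mcTwo, funext (mc_congr hΩ (h 1) hz)]
  subleading z hz v := (hξ.subleading z hz v).trans <| by rw [mc_congr hΩ (h 1) hz]

theorem IsMatchedKillingField.isQuasiFiniteType (hξ : IsMatchedKillingField Ω F p ξ)
    (hF : IsFamily Ω F) (hΩ : IsOpen Ω) (hsc : IsSimplyConnected Ω) (htw : IsTwistedOn Ω ξ) :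
    IsQuasiFiniteType Ω F :=
  ⟨hF, p, ξ, hξ.hasConstLeading hF hΩ htw hsc, (isQuasiAdapted_iff hF hΩ).2 ⟨hξ, htw⟩⟩

theorem IsQuasiAdapted.exists_gauge (hξ : IsQuasiAdapted Ω F p ξ) (hF : IsFamily Ω F)
    (hΩ : IsOpen Ω) (hsc : IsSimplyConnected Ω) {z₀ : ℂ} (hz₀ : z₀ ∈ Ω) :
    ∃ G, IsGauge Ω G ∧ G z₀ = 1 ∧ HasConstLeading Ω p (gaugeLoop ξ G) ∧
      IsAdapted Ω (gaugeF F G) p (gaugeLoop ξ G) := by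
  obtain ⟨hmatched, htw⟩ := (isQuasiAdapted_iff hF hΩ).1 hξ
  obtain ⟨G, hG, hG₀, hadapted⟩ := hmatched.exists_gauge_isAdapted hF hΩ hsc htw hz₀
  exact ⟨G, hG, hG₀, (hmatched.gauge hF hΩ hG).hasConstLeading (hF.gauge hΩ hG) hΩ (htw.gauge hG)
    hsc, hadapted⟩

theorem isQuasiFiniteType_iff_exists_gauge (hF : IsFamily Ω F) (hΩ : IsOpen Ω)
    (hsc : IsSimplyConnected Ω) :
    IsQuasiFiniteType Ω F ↔ ∃ G, IsGauge Ω G ∧ IsFiniteType Ω (gaugeF F G) := by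
  constructor
  · rintro ⟨-, p, ξ, -, hξ⟩
    obtain ⟨z₀, hz₀⟩ := hsc.nonempty
    obtain ⟨G, hG, -, hlead, hadapted⟩ := hξ.exists_gauge hF hΩ hsc hz₀
    exact ⟨G, hG, hF.gauge hΩ hG, p, _, hlead, hadapted⟩
  · rintro ⟨G, hG, hFG, p, ξ, -, hξ⟩
    obtain ⟨hmatched, htw⟩ := (isQuasiAdapted_iff hFG hΩ).1 hξ.isQuasiAdapted
    refine ((hmatched.gauge hFG hΩ hG.inv).congr hΩ fun l z hz => ?_).isQuasiFiniteType hF hΩ hsc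
      (htw.gauge hG.inv)
    exact Matrix.mul_nonsing_inv_cancel_right _ _ (hG.isUnitaryGauge.isUnit_det hz)

end QuasiFiniteType

section TwistAverage

/-- The projection of `Λ^n u(3)` onto `Λ^n u(3)_τ`, i.e. the average over the automorphism
`ξ_λ ↦ τ⁻¹(ξ_{iλ})` of order `4`. -/
def twistAverage (n : ℕ) (ξ : Loop) : Loop :=
  ∑ k ∈ Finset.Icc (-(n : ℤ)) n, AddMonoidAlgebra.single k (tauComp k (ξ.coeff k))

theorem tauComp_zero_right (a : ℤ) : tauComp a 0 = 0 :=
  (tauCompLin a).map_zero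

theorem coeff_twistAverage {n : ℕ} {ξ : Loop} (hξ : ξ ∈ LoopU n) (k : ℤ) :
    (twistAverage n ξ).coeff k = tauComp k (ξ.coeff k) := by
  simp only [twistAverage, AddMonoidAlgebra.coeff_sum, Finsupp.finsetSum_apply,
    AddMonoidAlgebra.coeff_single, Finsupp.single_apply]
  rw [Finset.sum_ite_eq']
  refine ite_eq_left_iff.2 fun hk => ?_
  rw [coeff_eq_zero_of_notMem_Icc hξ.1 hk, tauComp_zero_right]

theorem twistAverage_mem_LoopU {n : ℕ} {ξ : Loop} (hξ : ξ ∈ LoopU n) :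
    twistAverage n ξ ∈ LoopU n := by
  refine mem_LoopU_iff.2 ⟨fun k hk => ?_, fun k => ?_⟩
  · rw [coeff_twistAverage hξ, hξ.1 k hk, tauComp_zero_right]
  · rw [coeff_twistAverage hξ, coeff_twistAverage hξ, tauComp_conjTranspose,
      (mem_LoopU_iff.1 hξ).2, tauComp_neg, neg_neg]

theorem mcTwo_mem_uC (f : ℂ → M3) (z v : ℂ) : mcTwo f z v ∈ uC 2 :=
  smul_mem_uC _ (smul_mem_uC _ (sub_mem_uC (tauComp_mem 2 _) (smul_mem_uC _ (tauComp_mem 2 _))))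

theorem coeff_twistAverage_lie_mcLoop {n : ℕ} {ξ : Loop} (hξ : ξ ∈ LoopU n) (f : ℂ → M3) (z v : ℂ)
    (k : ℤ) : (⁅twistAverage n ξ, mcLoop f z v⁆ : Loop).coeff k =
      tauComp k ((⁅ξ, mcLoop f z v⁆ : Loop).coeff k) := by
  have htwo : mcTwo f z v ∈ uC (-2) :=
    uC_eq_of_dvd (show (4 : ℤ) ∣ -2 - 2 by norm_num) ▸ mcTwo_mem_uC f z v
  have hone := tauComp_mem (-1) (mc f z v)
  rw [mcLoop, coeff_lie_shortLoop, coeff_lie_shortLoop, tauComp_sub, tauComp_sub, tauComp_add,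
    tauComp_add, tauComp_lie_of_mem_uC htwo, tauComp_lie_of_mem_uC hone,
    tauComp_lie_of_mem_uC (tauComp_mem 0 _), tauComp_lie_of_mem_uC (conjTranspose_mem_uC hone),
    tauComp_lie_of_mem_uC (conjTranspose_mem_uC htwo)]
  simp only [coeff_twistAverage hξ, sub_neg_eq_add, neg_neg, sub_zero]

variable {Ω : Set ℂ} {F : Circle → ℂ → M3} {n p : ℕ} {ξ : ℂ → Loop}

theorem IsKillingField.twistAverage (hξ : IsKillingField Ω (fun l => mc (F l)) n ξ)
    (hF : IsFamily Ω F) (hΩ : IsOpen Ω) :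
    IsKillingField Ω (fun l => mc (F l)) n fun z => twistAverage n (ξ z) := by
  have hmem := fun z hz => twistAverage_mem_LoopU (hξ.mem z hz)
  have hsmooth : SmoothLoop Ω fun z => HamStat.twistAverage n (ξ z) := fun k =>
    (contDiffOn_linearMap_comp ((tauCompLin k).restrictScalars ℝ) (hξ.smooth k)).congr
      fun z hz => coeff_twistAverage (hξ.mem z hz) k
  refine ⟨hmem, hsmooth, fun l z hz v => ?_⟩
  have hmc := fun l => hF.evalAt_mcLoop hΩ l hz v
  have hcoeff := (fderiv_evalAt_eq_lie_iff hΩ hξ.mem hξ.smooth hz v (mcLoop (F 1) z v)).1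
    fun l => (hξ.lax l z hz v).trans (by rw [hmc])
  rw [← hmc]
  refine (fderiv_evalAt_eq_lie_iff hΩ hmem hsmooth hz v (mcLoop (F 1) z v)).2 (fun k => ?_) l
  have hcongr : (fun w => (HamStat.twistAverage n (ξ w)).coeff k) =ᶠ[nhds z]
      fun w => tauComp k ((ξ w).coeff k) := by
    filter_upwards [hΩ.mem_nhds hz] with w hw using coeff_twistAverage (hξ.mem w hw) k
  rw [coeff_twistAverage_lie_mcLoop (hξ.mem z hz), ← hcoeff, hcongr.fderiv_eq]
  exact fderiv_linearMap_comp_apply ((tauCompLin k).restrictScalars ℝ)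
    (differentiableAt_of_contDiffOn hΩ (hξ.smooth k) hz) v

theorem IsMatchedKillingField.twistAverage (hξ : IsMatchedKillingField Ω F p ξ)
    (hF : IsFamily Ω F) (hΩ : IsOpen Ω) :
    IsMatchedKillingField Ω F p fun z => twistAverage (2 + 4 * p) (ξ z) where
  toIsKillingField := hξ.toIsKillingField.twistAverage hF hΩ
  leading z hz v := by
    rw [coeff_twistAverage (hξ.mem z hz), ← tauComp_smul, hξ.leading z hz,
      tauComp_of_mem_uC (mcTwo_mem_uC _ _ _), if_pos (by omega)]
  subleading z hz v := by
    rw [coeff_twistAverage (hξ.mem z hz), ← tauComp_smul, hξ.subleading z hz,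
      tauComp_of_mem_uC (tauComp_mem _ _), if_pos (by omega)]

theorem isTwistedOn_twistAverage (hξ : ∀ z ∈ Ω, ξ z ∈ LoopU n) :
    IsTwistedOn Ω fun z => twistAverage n (ξ z) := fun z hz k => by
  rw [coeff_twistAverage (hξ z hz)]
  exact tauComp_mem k _

theorem isQuasiFiniteType_iff_exists_isMatchedKillingField (hF : IsFamily Ω F) (hΩ : IsOpen Ω)
    (hsc : IsSimplyConnected Ω) :
    IsQuasiFiniteType Ω F ↔ ∃ p ξ, IsMatchedKillingField Ω F p ξ :=
  ⟨fun ⟨_, p, ξ, _, hξ⟩ => ⟨p, ξ, ((isQuasiAdapted_iff hF hΩ).1 hξ).1⟩, fun ⟨_, _, hξ⟩ =>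
    (hξ.twistAverage hF hΩ).isQuasiFiniteType hF hΩ hsc (isTwistedOn_twistAverage hξ.mem)⟩

end TwistAverage

section Based

theorem forall_evalAt_shortLoop_sub_eq_iff {a b c a' b' c' : M3} :
    (∀ l, (shortLoop a b c).evalAt l - (shortLoop a b c).evalAt 1 =
      (shortLoop a' b' c').evalAt l - (shortLoop a' b' c').evalAt 1) ↔ a = a' ∧ b = b' := by
  constructor
  · intro h
    have heq := shortLoop_inj (Loop.ext_evalAt fun l => by
      simpa only [← evalAt_shortLoop_add, sub_eq_add_neg] using h l)
    exact ⟨heq.1, heq.2.1⟩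
  · rintro ⟨rfl, rfl⟩ l
    simp only [evalAt_shortLoop]
    abel

variable {Ω : Set ℂ} {F : Circle → ℂ → M3} {p : ℕ} {z : ℂ}

theorem IsFamily.mc_based (hF : IsFamily Ω F) (hΩ : IsOpen Ω) (l : Circle) (hz : z ∈ Ω) (v : ℂ) :
    mc (based F l) z v = F 1 z * (mc (F l) z v - mc (F 1) z v) * (F 1 z)⁻¹ := by
  have hu := hF.isUnitaryGauge 1
  refine (hF.mc_gaugeF hΩ hu.inv l hz v).trans ?_
  rw [gaugeA, fderiv_matrix_inv_apply (hu.differentiableAt hΩ hz) (hu.isUnit hz),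
    Matrix.nonsing_inv_nonsing_inv _ (hu.isUnit_det hz), mul_neg, ← sub_eq_add_neg, ← mul_assoc,
    ← sub_mul, ← mul_sub, mc, mc]

theorem IsFamily.gaugeA_based (hF : IsFamily Ω F) (hΩ : IsOpen Ω) (l : Circle) (hz : z ∈ Ω)
    (v : ℂ) : gaugeA (fun l => mc (based F l)) (F 1) l z v = mc (F l) z v := by
  have hdet := (hF.isUnitaryGauge 1).isUnit_det hz
  rw [gaugeA, hF.mc_based hΩ l hz, mul_assoc (F 1 z), Matrix.nonsing_inv_mul_cancel_left _ _ hdet,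
    Matrix.nonsing_inv_mul_cancel_right _ _ hdet]
  exact sub_add_cancel _ _

theorem IsFamily.forall_mc_based_eq_iff (hF : IsFamily Ω F) (hΩ : IsOpen Ω) (hz : z ∈ Ω) {η : Loop}
    (hη : η ∈ LoopU (2 + 4 * p)) (v : ℂ) :
    (∀ l, mc (based F l) z v = (shifted p η v).projBased.evalAt l) ↔
      v • ((F 1 z)⁻¹ * η.coeff (-4 * (p : ℤ) - 2) * F 1 z) = mcTwo (F 1) z v ∧
      v • ((F 1 z)⁻¹ * η.coeff (-4 * (p : ℤ) - 1) * F 1 z) = tauComp (-1) (mc (F 1) z v) := by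
  have hu := hF.isUnitaryGauge 1
  have hdet := hu.isUnit_det hz
  have hconj : ∀ M N : M3, F 1 z * M * (F 1 z)⁻¹ = N ↔ (F 1 z)⁻¹ * N * F 1 z = M := fun M N => by
    constructor <;> rintro rfl
    · rw [mul_assoc (F 1 z), Matrix.nonsing_inv_mul_cancel_left _ _ hdet,
        Matrix.nonsing_inv_mul_cancel_right _ _ hdet]
    · rw [mul_assoc (F 1 z)⁻¹, Matrix.mul_nonsing_inv_cancel_left _ _ hdet,
        Matrix.mul_nonsing_inv_cancel_right _ _ hdet]
  have hsmul : ∀ M : M3, v • ((F 1 z)⁻¹ * M * F 1 z) = (F 1 z)⁻¹ * (v • M) * F 1 z := fun M => by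
    rw [mul_smul_comm, smul_mul_assoc]
  rw [hsmul, hsmul, ← forall_evalAt_shortLoop_sub_eq_iff (c := (F 1 z)⁻¹ * 0 * F 1 z)
      (c' := tauComp 0 (mc (F 1) z v)), ← shortLoop_conj (hu.unitary z hz)]
  refine forall_congr' fun l => ?_
  have hmc := fun l => hF.evalAt_mcLoop hΩ l hz v
  simp only [mcLoop] at hmc
  rw [hF.mc_based hΩ l hz, hconj, evalAt_projBased_shifted hη, hmc, hmc, mul_sub, sub_mul,
    Loop.evalAt_conj, Loop.evalAt_conj]

theorem isBasedFiniteType_iff_exists_isMatchedKillingField (hF : IsFamily Ω F) (hΩ : IsOpen Ω) :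
    IsBasedFiniteType Ω (based F) ↔ ∃ p ξ, IsMatchedKillingField Ω F p ξ := by
  have hu := hF.isUnitaryGauge 1
  constructor
  · rintro ⟨p, η, hmem, hsmooth, hlax, hη⟩
    have hcoeff := fun z hz v =>
      (hF.forall_mc_based_eq_iff hΩ hz (hmem z hz) v).1 fun l => hη l z hz v
    simp only [← coeff_gaugeLoop] at hcoeff
    have hkilling : IsKillingField Ω (fun l => mc (based F l)) (2 + 4 * p) η :=
      ⟨hmem, hsmooth, hlax⟩
    exact ⟨p, gaugeLoop η (F 1), (hkilling.gauge hΩ hu).congr fun l z hz => hF.gaugeA_based hΩ l hz,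
      fun z hz v => (hcoeff z hz v).1, fun z hz v => (hcoeff z hz v).2⟩
  · rintro ⟨p, ξ, hξ⟩
    have hkilling : IsKillingField Ω (fun l => mc (based F l)) (2 + 4 * p)
        (gaugeLoop ξ fun z => (F 1 z)⁻¹) := (hξ.toIsKillingField.gauge hΩ hu.inv).congr
      fun l z hz v => (hF.mc_gaugeF hΩ hu.inv l hz v).symm
    refine ⟨p, _, hkilling.mem, hkilling.smooth, hkilling.lax, fun l z hz v => ?_⟩
    have hdet := hu.isUnit_det hz
    refine (hF.forall_mc_based_eq_iff hΩ hz (hkilling.mem z hz) v).2 ?_ l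
    rw [coeff_gaugeLoop, coeff_gaugeLoop, Matrix.nonsing_inv_nonsing_inv _ hdet]
    simp only [mul_assoc, Matrix.nonsing_inv_mul _ hdet, mul_one,
      Matrix.nonsing_inv_mul_cancel_left _ _ hdet]
    exact ⟨hξ.leading z hz v, hξ.subleading z hz v⟩

end Based

end HamStat

end

theorem theorem3p3 (Ω : Set ℂ) (hΩ : IsOpen Ω) (hsc : IsSimplyConnected Ω)
    (z₀ : ℂ) (hz₀ : z₀ ∈ Ω) (F : Circle → ℂ → M3) (hF : IsFamily Ω F) :
    (∀ (p : ℕ) (ξ : ℂ → Loop), IsQuasiAdapted Ω F p ξ →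
      ∃ G : ℂ → M3, IsGauge Ω G ∧ G z₀ = 1 ∧
        IsFiniteType Ω (gaugeF F G) ∧
        HasConstLeading Ω p (gaugeLoop ξ G) ∧
        IsAdapted Ω (gaugeF F G) p (gaugeLoop ξ G) ∧
        ∀ l, ∀ z ∈ Ω, ∀ v,
          mc (gaugeF F G l) z v
            = gaugeA (fun m => mc (F m)) G l z v ∧
          fderiv ℝ (fun w => (gaugeLoop ξ G w).evalAt l) z v
              + ⁅gaugeA (fun m => mc (F m)) G l z v,
                  (gaugeLoop ξ G z).evalAt l⁆
            = (G z)⁻¹ * (fderiv ℝ (fun w => (ξ w).evalAt l) z v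
                + ⁅mc (F l) z v, (ξ z).evalAt l⁆) * G z ∧
          fderiv ℝ (fun w => (gaugeLoop ξ G w).evalAt l) z v
              + ⁅gaugeA (fun m => mc (F m)) G l z v,
                  (gaugeLoop ξ G z).evalAt l⁆ = 0 ∧
          (shifted p (gaugeLoop ξ G z) v).projSu.evalAt l
            = gaugeA (fun m => mc (F m)) G l z v) ∧
    (IsQuasiFiniteType Ω F ↔
      ∃ G : ℂ → M3, IsGauge Ω G ∧
        IsFiniteType Ω (gaugeF F G)) ∧
    ((∃ G : ℂ → M3, IsGauge Ω G ∧
        IsFiniteType Ω (gaugeF F G)) ↔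
      IsBasedFiniteType Ω (based F)) := by
  refine ⟨fun p ξ hξ => ?_, isQuasiFiniteType_iff_exists_gauge hF hΩ hsc,
    (isQuasiFiniteType_iff_exists_gauge hF hΩ hsc).symm.trans
      ((isQuasiFiniteType_iff_exists_isMatchedKillingField hF hΩ hsc).trans
        (isBasedFiniteType_iff_exists_isMatchedKillingField hF hΩ).symm)⟩
  obtain ⟨G, hG, hG₀, hlead, hadapted⟩ := hξ.exists_gauge hF hΩ hsc hz₀
  refine ⟨G, hG, hG₀, ⟨hF.gauge hΩ hG, p, _, hlead, hadapted⟩, hlead, hadapted, fun l z hz v => ?_⟩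
  have hmc := hF.mc_gaugeF hΩ hG.isUnitaryGauge l hz v
  refine ⟨hmc, lax_gauge hΩ (fun z hz => (hξ.mem z hz).1) hξ.smooth hG.isUnitaryGauge l hz v, ?_,
    (hadapted.adapted l z hz v).trans hmc⟩
  rw [hadapted.lax l z hz v, ← ring_lie_skew, ← hmc, neg_add_cancel]
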